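/- **Theorem 2.1.** Let $\mathbb{F}_q$ be a finite field with $q$ elements, and for $n\ge 1$ let $p_n$ be the number of $\mathbb{F}_q$-algebra automorphisms $\varphi=(f,g)$ of $\mathbb{F}_q[x,y]$ (where $f=\varphi(x)$, $g=\varphi(y)$) with $\max\{\deg f,\deg g\}=n$, where $\deg$ is the total degree. (i) $p_1=q^3(q-1)^2(q+1)$, and for every $n>1$ $$p_n=(q(q-1)(q+1))^2\sum\left(\frac{q-1}{q}\right)^k q^{n_1+\cdots+n_k},$$ where the sum is over all ordered factorizations $n=n_1\cdots n_k$ of $n$ into integers $n_1,\dots,n_k>1$. (ii) Let $\rho(s)=\sum_{n\ge 2}\frac{q^n}{n^s}$. In the ring of formal Dirichlet series with rational coefficients (with Dirichlet convolution as product), $1-\frac{q-1}{q}\rho(s)$ is invertible, and $$p(s)=\sum_{n\ge 1}\frac{p_n}{n^s}=(q(q-1)(q+1))^2\left(\frac{1}{1-\frac{q-1}{q}\rho(s)}-\frac{1}{q+1}\right).$$ -/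

import Mathlib

/-- The degree `max {deg f, deg g}` of the automorphism `φ = (f, g)` of `F[x, y]`,
where `f = φ(x)` and `g = φ(y)`. -/
noncomputable def autDegree {F : Type*} [Field F]
    (φ : MvPolynomial (Fin 2) F ≃ₐ[F] MvPolynomial (Fin 2) F) : ℕ :=
  max (φ (MvPolynomial.X 0)).totalDegree (φ (MvPolynomial.X 1)).totalDegree

/-- The number `p_n` of `F`-automorphisms of `F[x, y]` of degree `n`. -/
noncomputable def autCount (F : Type*) [Field F] (n : ℕ) : ℕ :=
  Nat.card {φ : MvPolynomial (Fin 2) F ≃ₐ[F] MvPolynomial (Fin 2) F // autDegree φ = n}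

/-- The ordered factorizations `n = n_1 ⋯ n_k` with all `n_i > 1` form a finite set
(the empty list, `k = 0`, is the only one for `n = 1` and does not occur for `n > 1`). -/
theorem finite_orderedFactorizations (n : ℕ) :
    {l : List ℕ | (∀ m ∈ l, 1 < m) ∧ l.prod = n}.Finite := by
  have hpow : ∀ l : List ℕ, (∀ m ∈ l, 1 < m) → 2 ^ l.length ≤ l.prod := by
    intro l
    induction l with
    | nil => simp
    | cons a t ih =>
      intro h
      have h1 : 1 < a := h a (by simp)
      have h2 := ih (fun m hm => h m (by simp [hm]))
      rw [List.length_cons, List.prod_cons, pow_succ, mul_comm]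
      exact Nat.mul_le_mul h1 h2
  refine ((List.finite_length_le (Fin (n + 1)) n).image (List.map Fin.val)).subset ?_
  rintro l ⟨h, rfl⟩
  have hlen : l.length ≤ l.prod := (Nat.lt_two_pow_self).le.trans (hpow l h)
  have hpos : 0 < l.prod := lt_of_lt_of_le (by positivity) (hpow l h)
  have hmem : ∀ m ∈ l, m < l.prod + 1 := fun m hm =>
    Nat.lt_succ_of_le (Nat.le_of_dvd hpos (List.dvd_prod hm))
  refine ⟨l.pmap (fun m hm => (⟨m, hm⟩ : Fin (l.prod + 1))) hmem, ?_, ?_⟩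
  · simpa using hlen
  · simp [List.map_pmap]

/-- The finite set of ordered factorizations `n = n_1 ⋯ n_k` with all `n_i > 1`,
encoded as the lists `[n_1, …, n_k]`. -/
noncomputable def orderedFactorizations (n : ℕ) : Finset (List ℕ) :=
  (finite_orderedFactorizations n).toFinset

/-- The formal Dirichlet series `∑_{n ≥ 1} a_n / n^s` of a sequence of rational numbers, as an
element of the ring `ArithmeticFunction ℚ` of formal Dirichlet series (the product is Dirichlet
convolution, `1` is the series with the only nonzero coefficient `a_1 = 1`, and a scalar `c`
acts coefficientwise). The value `a 0` is not used. -/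
def formalDirichletSeries (a : ℕ → ℚ) : ArithmeticFunction ℚ :=
  ⟨fun n => if n = 0 then 0 else a n, by simp⟩

/-- The formal Dirichlet series `ρ(s) = ∑_{n ≥ 2} q^n / n^s`. -/
def rhoSeries (q : ℚ) : ArithmeticFunction ℚ :=
  formalDirichletSeries (fun n => if 2 ≤ n then q ^ n else 0)

/-- The formal Dirichlet series `p(s) = ∑_{n ≥ 1} p_n / n^s`. -/
noncomputable def autSeries (F : Type*) [Field F] : ArithmeticFunction ℚ :=
  formalDirichletSeries (fun n => (autCount F n : ℚ))

/-!
Everything rests on one step of degree reduction, which is the Jung–van der Kulk theorem in its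
quantitative form (`exists_totalDegree_sub_lt`): if `(f, g)` is an automorphism with
`deg g ≤ deg f` and `deg f ≥ 2`, then `deg (f - c g ^ k) < deg f` for suitable `c` and `k`. It holds
over every field; the argument below works in all characteristics.

Let `(P, Q)` be the inverse automorphism and give `u`, `v` the weights `deg f`, `deg g`. The leading
form of the identity `P(f, g) = x` (or of `Q(f, g) = y`) is a weighted homogeneous relation between
the leading forms of `f` and `g`. It forces `f₀ ^ l = c g₀ ^ k` with `k`, `l` coprime
(`exists_pow_eq_C_mul_pow`), and makes `u ^ l - c v ^ k` divide the leading form of `P`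
(`binomial_dvd`). The claim is that `l = 1`. Now `P ↦ P`, `Q ↦ Q + T` defines an action of the
additive group on `F[u, v]`; for a suitable weight of `T` (`exists_weight`) its leading part
`(U', V')` is still nontrivial and fixes the leading form of `P`. A factor of an invariant is
invariant, so `U' ^ l - c V' ^ k = u ^ l - c v ^ k`. If `k, l ≥ 2` this is impossible
(`cusp_rigid`): when the characteristic divides neither `k` nor `l` it contradicts the polynomial
Catalan theorem, a consequence of Mason–Stothers, and otherwise one differentiates with respect to
`u` or `v`. This is `exponent_eq_one`.

Iterating the reduction gives a normal form: an automorphism `(h, f)` with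
`deg f = m < n = deg h` is uniquely `(g + R(f), f)` with `deg g ≤ m`, where `R` has degree `n / m` and
neither constant nor linear term. Writing `s n` for the number of automorphisms `(f, g)` with
`deg g ≤ deg f = n`, this yields `s n = ∑ ((q - 1) / q) q ^ (n / m) s m` over the proper divisors `m`
of `n ≥ 2`, and `p n = ((q + 1) / q) s n`. The sum over ordered factorizations satisfies the same
recursion (split off the first factor), and `s 1` is the number of affine automorphisms. The
recursion also says that this sum is the Dirichlet inverse of `1 - ((q - 1) / q) ρ(s)`.
-/

open MvPolynomial

/-! ### Leading forms for rational weights -/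

/-- All monomials of `p` have weight at most `N`. -/
def WeightLE {σ F : Type*} [CommSemiring F] (w : σ → ℚ) (N : ℚ) (p : MvPolynomial σ F) : Prop :=
  ∀ d ∈ p.support, Finsupp.weight w d ≤ N

namespace WeightLE

variable {σ τ F : Type*} [CommRing F] {w : σ → ℚ} {N M : ℚ} {p q : MvPolynomial σ F}

theorem coeff_eq_zero (h : WeightLE w N p) {d : σ →₀ ℕ} (hd : N < Finsupp.weight w d) :
    coeff d p = 0 := by
  by_contra hc
  exact absurd (h d (mem_support_iff.mpr hc)) (not_le.mpr hd)

theorem of_coeff (h : ∀ d, N < Finsupp.weight w d → coeff d p = 0) : WeightLE w N p := by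
  intro d hd
  by_contra hc
  exact mem_support_iff.mp hd (h d (not_le.mp hc))

theorem mono (h : WeightLE w N p) (hNM : N ≤ M) : WeightLE w M p :=
  fun d hd => (h d hd).trans hNM

theorem component_eq_zero (h : WeightLE w N p) (hNM : N < M) :
    weightedHomogeneousComponent w M p = 0 := by
  classical
  ext d
  rw [coeff_weightedHomogeneousComponent, coeff_zero]
  split_ifs with hd
  · exact h.coeff_eq_zero (hd ▸ hNM)
  · rfl

theorem C (c : F) : WeightLE w 0 (C c : MvPolynomial σ F) := by
  classical
  intro d hd
  rw [mem_support_iff, coeff_C] at hd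
  have : d = 0 := by
    by_contra h
    exact hd (if_neg (Ne.symm h))
  simp [this]

theorem mul (hp : WeightLE w N p) (hq : WeightLE w M q) : WeightLE w (N + M) (p * q) := by
  classical
  refine of_coeff fun d hd => ?_
  rw [coeff_mul]
  refine Finset.sum_eq_zero fun x hx => ?_
  have hx' : Finsupp.weight w d = Finsupp.weight w x.1 + Finsupp.weight w x.2 := by
    rw [← Finset.HasAntidiagonal.mem_antidiagonal.mp hx, map_add]
  rcases lt_or_ge N (Finsupp.weight w x.1) with h | h
  · rw [hp.coeff_eq_zero h, zero_mul]
  · rw [hq.coeff_eq_zero (by linarith), mul_zero]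

theorem component_mul (hp : WeightLE w N p) (hq : WeightLE w M q) :
    weightedHomogeneousComponent w (N + M) (p * q) =
      weightedHomogeneousComponent w N p * weightedHomogeneousComponent w M q := by
  classical
  ext d
  rw [coeff_weightedHomogeneousComponent, coeff_mul, coeff_mul]
  have hx : ∀ x ∈ Finset.HasAntidiagonal.antidiagonal d,
      Finsupp.weight w d = Finsupp.weight w x.1 + Finsupp.weight w x.2 := fun x hx => by
    rw [← Finset.HasAntidiagonal.mem_antidiagonal.mp hx, map_add]
  split_ifs with hd
  · refine Finset.sum_congr rfl fun x hxm => ?_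
    have hxw := hx x hxm
    rw [coeff_weightedHomogeneousComponent, coeff_weightedHomogeneousComponent]
    rcases lt_trichotomy N (Finsupp.weight w x.1) with h | h | h
    · rw [if_neg h.ne', hp.coeff_eq_zero h, zero_mul, zero_mul]
    · rw [if_pos h.symm, if_pos (by linarith)]
    · rw [hq.coeff_eq_zero (by linarith), mul_zero]; simp
  · refine (Finset.sum_eq_zero fun x hxm => ?_).symm
    have hxw := hx x hxm
    rw [coeff_weightedHomogeneousComponent, coeff_weightedHomogeneousComponent]
    by_cases h1 : Finsupp.weight w x.1 = N
    · rw [if_neg (c := Finsupp.weight w x.2 = M) (fun h2 => hd (by rw [hxw, h1, h2])), mul_zero]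
    · rw [if_neg h1, zero_mul]

theorem one : WeightLE w 0 (1 : MvPolynomial σ F) ∧
    weightedHomogeneousComponent w 0 (1 : MvPolynomial σ F) = 1 :=
  ⟨by simpa using C (w := w) (1 : F), by
    classical
    simpa using (weightedHomogeneousComponent_of_mem (isWeightedHomogeneous_one F w) :
      weightedHomogeneousComponent w 0 (1 : MvPolynomial σ F) = _)⟩

theorem pow (hp : WeightLE w N p) (k : ℕ) : WeightLE w (k * N) (p ^ k) ∧
    weightedHomogeneousComponent w (k * N) (p ^ k) = weightedHomogeneousComponent w N p ^ k := by
  induction k with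
  | zero =>
    simpa using one (w := w) (F := F)
  | succ k ih =>
    rw [pow_succ, pow_succ, ← ih.2, ← ih.1.component_mul hp]
    have : ((k + 1 : ℕ) : ℚ) * N = k * N + N := by push_cast; ring
    rw [this]
    exact ⟨ih.1.mul hp, rfl⟩

theorem sum {ι : Type*} (s : Finset ι) (f : ι → MvPolynomial σ F)
    (h : ∀ i ∈ s, WeightLE w N (f i)) : WeightLE w N (∑ i ∈ s, f i) := by
  refine of_coeff fun d hd => ?_
  rw [coeff_sum]
  exact Finset.sum_eq_zero fun i hi => (h i hi).coeff_eq_zero hd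

theorem prod {ι : Type*} (s : Finset ι) (f : ι → MvPolynomial σ F) (a : ι → ℚ)
    (h : ∀ i ∈ s, WeightLE w (a i) (f i)) : WeightLE w (∑ i ∈ s, a i) (∏ i ∈ s, f i) ∧
    weightedHomogeneousComponent w (∑ i ∈ s, a i) (∏ i ∈ s, f i) =
      ∏ i ∈ s, weightedHomogeneousComponent w (a i) (f i) := by
  classical
  induction s using Finset.induction_on with
  | empty => simpa using one (w := w) (F := F)
  | insert i s hi ih =>
    have ih := ih fun j hj => h j (Finset.mem_insert_of_mem hj)
    have hi' := h i (Finset.mem_insert_self _ _)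
    rw [Finset.sum_insert hi, Finset.prod_insert hi, Finset.prod_insert hi, ← ih.2,
      ← hi'.component_mul ih.1]
    exact ⟨hi'.mul ih.1, rfl⟩

/-- Taking leading forms commutes with substitution: if `p i` has weight at most `a i`, then the
component of `R(p)` in the weight bounding `R` (for the weights `a`) is obtained by substituting
the components of the `p i` into the component of `R`. -/
theorem aeval {a : τ → ℚ} {R : MvPolynomial τ F} {p : τ → MvPolynomial σ F}
    (hp : ∀ i, WeightLE w (a i) (p i)) (hR : WeightLE a N R) :
    WeightLE w N (aeval p R) ∧ weightedHomogeneousComponent w N (MvPolynomial.aeval p R) =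
      MvPolynomial.aeval (fun i => weightedHomogeneousComponent w (a i) (p i))
        (weightedHomogeneousComponent a N R) := by
  classical
  have key : ∀ d : τ →₀ ℕ, ∀ c : F,
      WeightLE w (Finsupp.weight a d) (MvPolynomial.aeval p (monomial d c)) ∧
      weightedHomogeneousComponent w (Finsupp.weight a d) (MvPolynomial.aeval p (monomial d c)) =
      MvPolynomial.aeval (fun i => weightedHomogeneousComponent w (a i) (p i)) (monomial d c) := by
    intro d c
    have h := WeightLE.prod (w := w) d.support (fun i => p i ^ d i) (fun i => d i * a i)
      (fun i _ => ((hp i).pow (d i)).1)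
    have hw : Finsupp.weight a d = ∑ i ∈ d.support, (d i : ℚ) * a i := by
      simp [Finsupp.weight_apply, Finsupp.sum]
    rw [aeval_monomial, aeval_monomial, Finsupp.prod, Finsupp.prod, algebraMap_eq, hw,
      weightedHomogeneousComponent_C_mul, h.2]
    refine ⟨by simpa using (C (w := w) c).mul h.1, ?_⟩
    congr 1
    exact Finset.prod_congr rfl fun i _ => ((hp i).pow (d i)).2
  have h1 : MvPolynomial.aeval p R =
      ∑ d ∈ R.support, MvPolynomial.aeval p (monomial d (coeff d R)) := by
    rw [← map_sum, ← as_sum]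
  constructor
  · rw [h1]
    exact sum _ _ fun d hd => (key d _).1.mono (hR d hd)
  · rw [h1, map_sum, weightedHomogeneousComponent_apply, map_sum, Finset.sum_filter]
    refine Finset.sum_congr rfl fun d hd => ?_
    split_ifs with hN
    · rw [← hN]; exact (key d _).2
    · exact (key d _).1.component_eq_zero (lt_of_le_of_ne (hR d hd) hN)

end WeightLE

/-! ### Polynomial families on a cuspidal curve -/

theorem degreeOf_pow_of_domain {σ F : Type*} [Field F] {p : MvPolynomial σ F} (hp : p ≠ 0)
    (i : σ) (k : ℕ) : degreeOf i (p ^ k) = k * degreeOf i p := by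
  classical
  induction k with
  | zero => simp
  | succ k ih => rw [pow_succ, degreeOf_mul_eq (pow_ne_zero _ hp) hp, ih]; ring

/-- A power of `V` dividing a power of a variable other than `X 0` does not involve `X 0`. -/
theorem degreeOf_zero_eq_zero_of_mul_eq {F : Type*} [Field F] {V W : MvPolynomial (Fin 3) F}
    {i : Fin 3} (hi : i ≠ 0) {k : ℕ} (hk : 2 ≤ k) (h : V ^ (k - 1) * W = X i ^ (k - 1)) :
    degreeOf 0 V = 0 := by
  have hne : V ^ (k - 1) * W ≠ 0 := h ▸ pow_ne_zero _ (X_ne_zero i)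
  have hV : V ≠ 0 := fun h0 => hne (by rw [h0, zero_pow (by omega), zero_mul])
  have h2 := congrArg (degreeOf 0) h
  rw [degreeOf_mul_eq (left_ne_zero_of_mul hne) (right_ne_zero_of_mul hne),
    degreeOf_pow_of_domain hV, degreeOf_pow_of_domain (X_ne_zero i), degreeOf_X_of_ne hi.symm] at h2
  have h3 : (k - 1) * degreeOf 0 V = 0 := by omega
  rcases Nat.mul_eq_zero.mp h3 with h4 | h4
  · omega
  · exact h4

theorem degreeOf_cusp_eq_zero {F : Type*} [Field F] {l k : ℕ} {c : F} :
    degreeOf 0 (X 1 ^ l - C c * X 2 ^ k : MvPolynomial (Fin 3) F) = 0 := by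
  have h1 : degreeOf 0 (X 1 ^ l : MvPolynomial (Fin 3) F) = 0 := by
    rw [degreeOf_pow_of_domain (X_ne_zero _), degreeOf_X_of_ne (by decide), mul_zero]
  have h2 : degreeOf 0 (C c * X 2 ^ k : MvPolynomial (Fin 3) F) = 0 := by
    have := degreeOf_C_mul_le (X 2 ^ k : MvPolynomial (Fin 3) F) 0 c
    rw [degreeOf_pow_of_domain (X_ne_zero _), degreeOf_X_of_ne (by decide), mul_zero] at this
    omega
  have := degreeOf_sub_le 0 (X 1 ^ l : MvPolynomial (Fin 3) F) (C c * X 2 ^ k)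
  omega

/-- The cuspidal curve `u ^ l - c v ^ k = h` over `F(u, v)` has no nonconstant polynomial
parametrization defined over `F[u, v]`: in good characteristic this is the Catalan case of the
Mason–Stothers theorem, and if the characteristic divides `l` or `k` one differentiates with
respect to `v` or `u`. -/
theorem cusp_rigid {F : Type*} [Field F] {l k : ℕ} (hl : 2 ≤ l) (hk : 2 ≤ k)
    (hlk : l.Coprime k) {c : F} (hc : c ≠ 0) {U V : MvPolynomial (Fin 3) F} (hU : U ≠ 0)
    (hV : V ≠ 0) (h : U ^ l - C c * V ^ k = X 1 ^ l - C c * X 2 ^ k) :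
    degreeOf 0 U = 0 ∧ degreeOf 0 V = 0 := by
  have hC : (C c : MvPolynomial (Fin 3) F) ≠ 0 := by simpa using hc
  have pd : ∀ i : Fin 3, (l : MvPolynomial (Fin 3) F) * U ^ (l - 1) * pderiv i U
      - C c * ((k : MvPolynomial (Fin 3) F) * V ^ (k - 1) * pderiv i V) =
      (l : MvPolynomial (Fin 3) F) * X 1 ^ (l - 1) * pderiv i (X 1)
        - C c * ((k : MvPolynomial (Fin 3) F) * X 2 ^ (k - 1) * pderiv i (X 2)) := by
    intro i
    have := congrArg (pderiv i) h
    simpa only [map_sub, pderiv_C_mul, pderiv_pow] using this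
  -- once one of the two is free of `X 0`, so is the other
  have hVU : degreeOf 0 V = 0 → degreeOf 0 U = 0 := by
    intro h0
    have e : U ^ l = (X 1 ^ l - C c * X 2 ^ k) + C c * V ^ k := by rw [← h]; ring
    have h1 := congrArg (degreeOf 0) e
    rw [degreeOf_pow_of_domain hU] at h1
    have h2 := degreeOf_add_le 0 (X 1 ^ l - C c * X 2 ^ k : MvPolynomial (Fin 3) F) (C c * V ^ k)
    rw [degreeOf_cusp_eq_zero] at h2
    have h3 := degreeOf_C_mul_le (V ^ k) 0 c
    rw [degreeOf_pow_of_domain hV, h0, mul_zero] at h3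
    have h4 : l * degreeOf 0 U = 0 := by omega
    rcases Nat.mul_eq_zero.mp h4 with h5 | h5
    · omega
    · exact h5
  have hUV : degreeOf 0 U = 0 → degreeOf 0 V = 0 := by
    intro h0
    have e : C c * V ^ k = U ^ l - (X 1 ^ l - C c * X 2 ^ k) := by rw [← h]; ring
    have h1 := congrArg (degreeOf 0) e
    rw [degreeOf_mul_eq hC (pow_ne_zero _ hV), degreeOf_C, degreeOf_pow_of_domain hV] at h1
    have h2 := degreeOf_sub_le 0 (U ^ l) (X 1 ^ l - C c * X 2 ^ k : MvPolynomial (Fin 3) F)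
    rw [degreeOf_cusp_eq_zero, degreeOf_pow_of_domain hU, h0, mul_zero] at h2
    have h4 : k * degreeOf 0 V = 0 := by omega
    rcases Nat.mul_eq_zero.mp h4 with h5 | h5
    · omega
    · exact h5
  -- the characteristic does not divide both exponents
  have hnot : ¬ ((l : F) = 0 ∧ (k : F) = 0) := by
    rintro ⟨h1, h2⟩
    rw [← Nat.cast_zero, CharP.cast_eq_iff_mod_eq F (ringChar F)] at h1 h2
    have h1' : ringChar F ∣ l := Nat.dvd_of_mod_eq_zero (by simpa using h1)
    have h2' : ringChar F ∣ k := Nat.dvd_of_mod_eq_zero (by simpa using h2)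
    have : ringChar F = 1 := Nat.dvd_one.mp (hlk ▸ Nat.dvd_gcd h1' h2')
    exact CharP.ringChar_ne_one this
  have cast_eq : ∀ n : ℕ, (n : MvPolynomial (Fin 3) F) = C (n : F) := fun n => by simp
  by_cases hl0 : (l : F) = 0
  · have hk0 : (k : F) ≠ 0 := fun h => hnot ⟨hl0, h⟩
    have hk0' : (C (k : F) : MvPolynomial (Fin 3) F) ≠ 0 := C_eq_zero.not.mpr hk0
    have h2 := pd 2
    rw [cast_eq l, cast_eq k, hl0, pderiv_X_self] at h2
    have h0 : degreeOf 0 V = 0 := by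
      refine degreeOf_zero_eq_zero_of_mul_eq (W := pderiv 2 V) (i := 2) (by decide) hk ?_
      apply mul_left_cancel₀ (mul_ne_zero hC hk0')
      simp only [map_zero, zero_mul, zero_sub, mul_one, neg_inj] at h2
      linear_combination h2
    exact ⟨hVU h0, h0⟩
  by_cases hk0 : (k : F) = 0
  · have hl0' : (C (l : F) : MvPolynomial (Fin 3) F) ≠ 0 := C_eq_zero.not.mpr hl0
    have h2 := pd 1
    rw [cast_eq l, cast_eq k, hk0, pderiv_X_self] at h2
    have h0 : degreeOf 0 U = 0 := by
      refine degreeOf_zero_eq_zero_of_mul_eq (W := pderiv 1 U) (i := 1) (by decide) hl ?_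
      apply mul_left_cancel₀ hl0'
      simp only [map_zero, zero_mul, mul_zero, sub_zero, mul_one] at h2
      linear_combination h2
    exact ⟨h0, hUV h0⟩
  let D := MvPolynomial (Fin 2) F
  let K := FractionRing D
  let θ : MvPolynomial (Fin 3) F →+* Polynomial K :=
    (Polynomial.mapRingHom (algebraMap D K)).comp (finSuccEquiv F 2).toRingHom
  have hinj : Function.Injective (algebraMap D K) := IsFractionRing.injective D K
  have hθ : ∀ p, (θ p).natDegree = degreeOf 0 p := by
    intro p
    change (Polynomial.map (algebraMap D K) (finSuccEquiv F 2 p)).natDegree = _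
    rw [Polynomial.natDegree_map_eq_of_injective hinj, natDegree_finSuccEquiv]
  have hθinj : Function.Injective θ :=
    (Polynomial.map_injective _ hinj).comp (finSuccEquiv F 2).injective
  have hθC : θ (C c) = Polynomial.C (algebraMap D K (C c)) := by
    change Polynomial.map (algebraMap D K) (finSuccEquiv F 2 (C c)) = _
    simp [finSuccEquiv_apply]
  set c' : K := algebraMap D K (C c) with hc'
  set w : D := X 0 ^ l - C c * X 1 ^ k with hw
  have hθw : θ (X 1 ^ l - C c * X 2 ^ k) = Polynomial.C (algebraMap D K w) := by
    rw [map_sub, map_mul, map_pow, map_pow, hθC]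
    have e1 : θ (X 1) = Polynomial.C (algebraMap D K (X 0)) := by
      change Polynomial.map (algebraMap D K) (finSuccEquiv F 2 (X (Fin.succ 0))) = _
      rw [finSuccEquiv_X_succ, Polynomial.map_C]
    have e2 : θ (X 2) = Polynomial.C (algebraMap D K (X 1)) := by
      change Polynomial.map (algebraMap D K) (finSuccEquiv F 2 (X (Fin.succ 1))) = _
      rw [finSuccEquiv_X_succ, Polynomial.map_C]
    rw [e1, e2, hw, hc']
    simp only [map_sub, map_mul, map_pow]
  have hc'0 : c' ≠ 0 := by
    rw [hc', Ne, map_eq_zero_iff _ hinj]; simpa using hc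
  have hw0 : w ≠ 0 := by
    intro h0
    have := congrArg (MvPolynomial.eval ![1, 0]) h0
    rw [hw] at this
    simp [show k ≠ 0 by omega] at this
  have hw0' : algebraMap D K w ≠ 0 := by rwa [Ne, map_eq_zero_iff _ hinj]
  have heq : θ U ^ l - Polynomial.C c' * θ V ^ k = Polynomial.C (algebraMap D K w) := by
    rw [← hθw, ← h, map_sub, map_mul, map_pow, map_pow, hθC]
  have castK : ∀ n : ℕ, (n : F) ≠ 0 → (n : K) ≠ 0 := by
    intro n hn h0
    apply hn
    have : algebraMap F K (n : F) = 0 := by rw [map_natCast]; exact h0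
    exact (map_eq_zero _).mp this
  have hcop : IsCoprime (θ U) (θ V) := by
    have h1 : IsCoprime (θ U ^ l) (θ V ^ k) := by
      refine ⟨Polynomial.C (algebraMap D K w)⁻¹, - Polynomial.C ((algebraMap D K w)⁻¹ * c'), ?_⟩
      calc _ = Polynomial.C (algebraMap D K w)⁻¹ *
            (θ U ^ l - Polynomial.C c' * θ V ^ k) := by rw [Polynomial.C_mul]; ring
        _ = 1 := by rw [heq, ← Polynomial.C_mul, inv_mul_cancel₀ hw0', Polynomial.C_1]
    exact (IsCoprime.pow_iff (by omega) (by omega)).mp h1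
  -- the exponent `l * k` is not a multiple of the characteristic and `1/l + 1/k + 1/(lk) ≤ 1`
  have hineq : k * (l * k) + l * k * l + l * k ≤ l * k * (l * k) := by
    have hne : l ≠ k := by
      rintro rfl
      rw [Nat.coprime_self] at hlk
      omega
    have : l + k + 1 ≤ l * k := by
      rcases lt_or_gt_of_ne hne with h | h
      · obtain ⟨a, rfl⟩ := Nat.exists_eq_add_of_le hl
        obtain ⟨b, rfl⟩ := Nat.exists_eq_add_of_le (show 3 ≤ k by omega)
        nlinarith
      · obtain ⟨a, rfl⟩ := Nat.exists_eq_add_of_le hk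
        obtain ⟨b, rfl⟩ := Nat.exists_eq_add_of_le (show 3 ≤ l by omega)
        nlinarith
    calc _ = l * k * (l + k + 1) := by ring
      _ ≤ _ := Nat.mul_le_mul_left _ this
  have main := Polynomial.flt_catalan (p := l) (q := k) (r := l * k) (by omega) (by omega)
    (Nat.mul_ne_zero (by omega) (by omega)) hineq (castK l hl0) (castK k hk0)
    (by rw [Nat.cast_mul]; exact mul_ne_zero (castK l hl0) (castK k hk0))
    (a := θ U) (b := θ V) (c := 1) ((map_ne_zero_iff _ hθinj).mpr hU)
    ((map_ne_zero_iff _ hθinj).mpr hV) one_ne_zero hcop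
    (u := 1) (v := -c') (w := -(algebraMap D K w)) one_ne_zero (neg_ne_zero.mpr hc'0)
    (neg_ne_zero.mpr hw0') (by
      rw [one_pow, mul_one, Polynomial.C_neg, Polynomial.C_neg, ← heq, Polynomial.C_1]; ring)
  exact ⟨(hθ U).symm.trans main.1, (hθ V).symm.trans main.2.1⟩

/-! ### Weighted homogeneous relations between two forms -/

theorem totalDegree_pow_eq {σ F : Type*} [Field F] (p : MvPolynomial σ F) (k : ℕ) :
    (p ^ k).totalDegree = k * p.totalDegree := by
  rcases eq_or_ne p 0 with rfl | hp
  · rcases Nat.eq_zero_or_pos k with rfl | hk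
    · simp
    · simp [zero_pow hk.ne']
  induction k with
  | zero => simp
  | succ k ih => rw [pow_succ, totalDegree_mul_of_isDomain (pow_ne_zero _ hp) hp, ih]; ring

theorem weight_fin_two (a : Fin 2 → ℚ) (d : Fin 2 →₀ ℕ) :
    Finsupp.weight a d = d 0 * a 0 + d 1 * a 1 := by
  rw [Finsupp.weight_apply, Finsupp.sum_fintype _ _ (by simp)]
  simp

/-- The monomials of a form of weights `(e * k, e * l)`, with `k` and `l` coprime, all come from
one monomial `u ^ i * v ^ j` by trading factors `v ^ k` for `u ^ l`. -/
theorem exists_exponents {F : Type*} [CommSemiring F] {e k l : ℕ} (he : 0 < e) (hl : 0 < l)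
    (hkl : k.Coprime l) {N : ℚ} {R : MvPolynomial (Fin 2) F}
    (hR : IsWeightedHomogeneous ![((e * k : ℕ) : ℚ), ((e * l : ℕ) : ℚ)] R N) :
    ∃ i j : ℕ, ∀ d ∈ R.support, d 0 = i + d 0 / l * l ∧ j = d 1 + d 0 / l * k := by
  rcases R.support.eq_empty_or_nonempty with h0 | ⟨b, hb⟩
  · exact ⟨0, 0, by simp [h0]⟩
  refine ⟨b 0 % l, b 1 + b 0 / l * k, fun d hd => ?_⟩
  have hd1 := hR (mem_support_iff.mp hd)
  have hb1 := hR (mem_support_iff.mp hb)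
  rw [weight_fin_two] at hd1 hb1
  simp only [Matrix.cons_val_zero, Matrix.cons_val_one] at hd1 hb1
  have h1 : e * (d 0 * k + d 1 * l) = e * (b 0 * k + b 1 * l) := by
    have : ((e * (d 0 * k + d 1 * l) : ℕ) : ℚ) = (e * (b 0 * k + b 1 * l) : ℕ) := by
      push_cast at hd1 hb1 ⊢
      linarith
    exact_mod_cast this
  have h2 := Nat.eq_of_mul_eq_mul_left he h1
  have h3 : d 0 * k ≡ b 0 * k [MOD l] := by
    have : (d 0 * k + d 1 * l) % l = (b 0 * k + b 1 * l) % l := by rw [h2]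
    simpa [Nat.ModEq] using this
  have h4 : d 0 % l = b 0 % l := Nat.ModEq.cancel_right_of_coprime hkl.symm h3
  have h5 : d 0 = b 0 % l + d 0 / l * l := by
    rw [← h4, mul_comm]; exact (Nat.mod_add_div _ _).symm
  have h6 : b 0 = b 0 % l + b 0 / l * l := by
    rw [mul_comm]; exact (Nat.mod_add_div _ _).symm
  refine ⟨h5, ?_⟩
  apply Nat.eq_of_mul_eq_mul_left hl
  generalize d 0 / l = s at *
  generalize b 0 / l = t at *
  generalize b 0 % l = i at *
  rw [h5, h6] at h2
  linarith

/-- Two forms of degrees `e * k` and `e * l` satisfying a weighted homogeneous relation have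
proportional powers: the quotient `f ^ l / g ^ k` is algebraic over `F`, hence, the polynomial
ring being integrally closed, it is a polynomial, and its degree is zero. -/
theorem exists_pow_eq_C_mul_pow {F : Type*} [Field F] {e k l : ℕ} (he : 0 < e) (hl : 0 < l)
    (hkl : k.Coprime l) {N : ℚ} {R : MvPolynomial (Fin 2) F} (hR0 : R ≠ 0)
    (hR : IsWeightedHomogeneous ![((e * k : ℕ) : ℚ), ((e * l : ℕ) : ℚ)] R N)
    {f g : MvPolynomial (Fin 2) F} (hf0 : f ≠ 0) (hg0 : g ≠ 0) (hf : f.totalDegree = e * k)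
    (hg : g.totalDegree = e * l) (h : aeval ![f, g] R = 0) :
    ∃ c : F, c ≠ 0 ∧ f ^ l = C c * g ^ k := by
  classical
  obtain ⟨i, j, hij⟩ := exists_exponents he hl hkl hR
  let D := MvPolynomial (Fin 2) F
  let K := FractionRing D
  have hinj : Function.Injective (algebraMap D K) := IsFractionRing.injective D K
  have hf' : algebraMap D K f ≠ 0 := by rwa [Ne, map_eq_zero_iff _ hinj]
  have hg' : algebraMap D K g ≠ 0 := by rwa [Ne, map_eq_zero_iff _ hinj]
  set x := algebraMap D K f with hx
  set y := algebraMap D K g with hy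
  set r : K := x ^ l / y ^ k with hr
  let p : Polynomial F := ∑ d ∈ R.support, Polynomial.monomial (d 0 / l) (coeff d R)
  have hp0 : p ≠ 0 := by
    obtain ⟨b, hb⟩ := (support_nonempty (p := R)).mpr hR0
    intro h0
    have h1 := congrArg (fun q => Polynomial.coeff q (b 0 / l)) h0
    simp only [p, Polynomial.finsetSum_coeff, Polynomial.coeff_monomial, Polynomial.coeff_zero] at h1
    rw [Finset.sum_eq_single b] at h1
    · rw [if_pos rfl] at h1
      exact mem_support_iff.mp hb h1
    · intro d hd hdb
      refine if_neg fun h2 => hdb ?_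
      have h3 := hij d hd
      have h4 := hij b hb
      rw [h2] at h3
      ext t
      fin_cases t
      · exact h3.1.trans h4.1.symm
      · change d 1 = b 1
        omega
    · exact fun h2 => absurd hb h2
  have hpr : Polynomial.aeval r p = 0 := by
    have h1 : x ^ i * y ^ j * Polynomial.aeval r p = algebraMap D K (aeval ![f, g] R) := by
      conv_rhs => rw [as_sum R]
      rw [map_sum, map_sum, map_sum, Finset.mul_sum]
      refine Finset.sum_congr rfl fun d hd => ?_
      obtain ⟨h3, h4⟩ := hij d hd
      rw [Polynomial.aeval_monomial, aeval_monomial, Finsupp.prod_fintype _ _ (by simp),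
        Fin.prod_univ_two, map_mul, map_mul, map_pow, map_pow]
      simp only [Matrix.cons_val_zero, Matrix.cons_val_one]
      rw [← hx, ← hy, ← IsScalarTower.algebraMap_apply F D K]
      generalize d 0 / l = s at *
      rw [h3, h4, hr, div_pow, pow_add, pow_add, mul_comm s l, mul_comm s k, pow_mul, pow_mul]
      have hy0 : (y ^ k) ^ s ≠ 0 := pow_ne_zero _ (pow_ne_zero _ hg')
      linear_combination (algebraMap F K (coeff d R) * x ^ i * y ^ d 1) *
        (mul_div_cancel₀ ((x ^ l) ^ s) hy0)
    rw [h, map_zero] at h1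
    exact (mul_eq_zero.mp h1).resolve_left
      (mul_ne_zero (pow_ne_zero _ hf') (pow_ne_zero _ hg'))
  have halg : IsAlgebraic F r := ⟨p, hp0, hpr⟩
  have hint : IsIntegral D r := halg.isIntegral.tower_top
  obtain ⟨z, hz⟩ := IsIntegrallyClosed.algebraMap_eq_of_integral hint
  have hzf : f ^ l = z * g ^ k := by
    apply hinj
    rw [map_pow, map_mul, map_pow, hz, ← hx, ← hy, hr, div_mul_cancel₀ _ (pow_ne_zero _ hg')]
  have hz0 : z ≠ 0 := by
    rintro rfl
    rw [zero_mul] at hzf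
    exact pow_ne_zero _ hf0 hzf
  have hdeg : z.totalDegree = 0 := by
    have h1 := congrArg totalDegree hzf
    rw [totalDegree_mul_of_isDomain hz0 (pow_ne_zero _ hg0), totalDegree_pow_eq,
      totalDegree_pow_eq, hf, hg] at h1
    have h2 : l * (e * k) = k * (e * l) := by ring
    omega
  rw [totalDegree_eq_zero_iff_eq_C] at hdeg
  refine ⟨coeff 0 z, fun h0 => hz0 (by rw [hdeg, h0, C_0]), ?_⟩
  rw [← hdeg, hzf]

/-- A weighted homogeneous relation between two forms with proportional powers is a multiple of
the binomial relation expressing that proportionality. -/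
theorem binomial_dvd {F : Type*} [Field F] {e k l : ℕ} (he : 0 < e) (hl : 0 < l)
    (hkl : k.Coprime l) {N : ℚ} {R : MvPolynomial (Fin 2) F}
    (hR : IsWeightedHomogeneous ![((e * k : ℕ) : ℚ), ((e * l : ℕ) : ℚ)] R N)
    {f g : MvPolynomial (Fin 2) F} (hf0 : f ≠ 0) (hg0 : g ≠ 0) {c : F}
    (hfg : f ^ l = C c * g ^ k) (h : aeval ![f, g] R = 0) :
    (X 0 ^ l - C c * X 1 ^ k) ∣ R := by
  classical
  obtain ⟨i, j, hij⟩ := exists_exponents he hl hkl hR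
  set H : MvPolynomial (Fin 2) F := X 0 ^ l - C c * X 1 ^ k with hH
  -- modulo the binomial every monomial of `R` is a multiple of the same monomial
  have hmon : ∀ d ∈ R.support, H ∣ monomial d (coeff d R) -
      C (coeff d R * c ^ (d 0 / l)) * (X 0 ^ i * X 1 ^ j) := by
    intro d hd
    obtain ⟨h3, h4⟩ := hij d hd
    have e1 : monomial d (coeff d R) = C (coeff d R) * (X 0 ^ d 0 * X 1 ^ d 1) := by
      rw [monomial_eq, Finsupp.prod_fintype _ _ (by simp), Fin.prod_univ_two]
    generalize d 0 / l = s at *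
    have e2 : monomial d (coeff d R) - C (coeff d R * c ^ s) * (X 0 ^ i * X 1 ^ j) =
        C (coeff d R) * (X 0 ^ i * X 1 ^ d 1) *
          ((X 0 ^ l) ^ s - (C c * X 1 ^ k) ^ s) := by
      rw [e1, h3, h4, C_mul, C_pow]
      ring
    rw [e2]
    exact (sub_dvd_pow_sub_pow _ _ s).mul_left _
  have hsum := Finset.dvd_sum hmon
  rw [Finset.sum_sub_distrib, ← as_sum, ← Finset.sum_mul, ← map_sum] at hsum
  set q := ∑ d ∈ R.support, coeff d R * c ^ (d 0 / l) with hq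
  have hq0 : q = 0 := by
    obtain ⟨Q, hQ⟩ := hsum
    have h1 := congrArg (aeval ![f, g]) hQ
    simp only [hH, map_sub, map_mul, map_pow, aeval_X, h, algHom_C, Matrix.cons_val_zero,
      Matrix.cons_val_one, algebraMap_eq, hfg, sub_self, zero_mul, zero_sub, neg_eq_zero] at h1
    rcases mul_eq_zero.mp h1 with h2 | h2
    · simpa using h2
    · exact absurd h2 (mul_ne_zero (pow_ne_zero _ hf0) (pow_ne_zero _ hg0))
  rwa [hq0, C_0, zero_mul, sub_zero] at hsum

/-! ### Leading forms of an automorphism -/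

theorem weight_one_eq {σ : Type*} (d : σ →₀ ℕ) :
    Finsupp.weight (fun _ : σ => (1 : ℚ)) d = ((d.sum fun _ e => e : ℕ) : ℚ) := by
  simp [Finsupp.weight_apply, Finsupp.sum]

theorem weightLE_one_iff {σ F : Type*} [CommSemiring F] {p : MvPolynomial σ F} {n : ℕ} :
    WeightLE (fun _ => 1) n p ↔ p.totalDegree ≤ n := by
  unfold WeightLE
  rw [totalDegree, Finset.sup_le_iff]
  simp only [weight_one_eq, Nat.cast_le]

/-- The leading form of `p`, the homogeneous component in degree `totalDegree p`; it is taken with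
rational weights so that it can be compared with the other weighted components. -/
noncomputable def leadingForm {σ F : Type*} [CommSemiring F] (p : MvPolynomial σ F) :
    MvPolynomial σ F :=
  weightedHomogeneousComponent (fun _ => (1 : ℚ)) (p.totalDegree : ℚ) p

theorem totalDegree_lt_of_component_eq_zero {σ F : Type*} [CommSemiring F] {p : MvPolynomial σ F}
    {n : ℕ} (hn : 0 < n) (hp : p.totalDegree ≤ n)
    (h : weightedHomogeneousComponent (fun _ => (1 : ℚ)) (n : ℚ) p = 0) : p.totalDegree < n := by
  classical
  rw [totalDegree, Finset.sup_lt_iff (by simpa using hn)]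
  intro d hd
  refine lt_of_le_of_ne ((le_totalDegree hd).trans hp) fun he => ?_
  have := congrArg (coeff d) h
  rw [coeff_weightedHomogeneousComponent, weight_one_eq, he, if_pos rfl, coeff_zero] at this
  exact mem_support_iff.mp hd this

theorem leadingForm_ne_zero {σ F : Type*} [CommSemiring F] {p : MvPolynomial σ F}
    (hp : 0 < p.totalDegree) : leadingForm p ≠ 0 := fun h =>
  lt_irrefl _ (totalDegree_lt_of_component_eq_zero hp le_rfl h)

theorem totalDegree_leadingForm {σ F : Type*} [CommSemiring F] {p : MvPolynomial σ F}
    (hp : 0 < p.totalDegree) : (leadingForm p).totalDegree = p.totalDegree := by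
  classical
  have key : ∀ d ∈ (leadingForm p).support, (d.sum fun _ e => e) = p.totalDegree := by
    intro d hd
    rw [mem_support_iff, leadingForm, coeff_weightedHomogeneousComponent] at hd
    by_contra hne
    refine hd (if_neg fun h => hne ?_)
    rw [weight_one_eq] at h
    exact_mod_cast h
  apply le_antisymm
  · exact Finset.sup_le fun d hd => (key d hd).le
  · obtain ⟨d, hd⟩ := support_nonempty.mpr (leadingForm_ne_zero hp)
    rw [← key d hd]
    exact le_totalDegree hd

theorem exists_top_component {σ F : Type*} [CommSemiring F] (w : σ → ℚ) {p : MvPolynomial σ F}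
    (hp : p ≠ 0) : ∃ N : ℚ, WeightLE w N p ∧ weightedHomogeneousComponent w N p ≠ 0 := by
  classical
  obtain ⟨d, hd, hmax⟩ := p.support.exists_max_image (Finsupp.weight w) (support_nonempty.mpr hp)
  refine ⟨Finsupp.weight w d, hmax, fun h => ?_⟩
  have := congrArg (coeff d) h
  rw [coeff_weightedHomogeneousComponent, if_pos rfl, coeff_zero] at this
  exact mem_support_iff.mp hd this

theorem weightLE_X {σ F : Type*} [CommRing F] (w : σ → ℚ) (i : σ) :
    WeightLE w (w i) (X i : MvPolynomial σ F) := by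
  intro d hd
  have : d = Finsupp.single i 1 := by
    have := support_monomial_subset (R := F) hd
    simpa using this
  rw [this, Finsupp.weight_single, one_smul]

theorem component_X {σ F : Type*} [CommRing F] (w : σ → ℚ) (i : σ) :
    weightedHomogeneousComponent w (w i) (X i : MvPolynomial σ F) = X i := by
  classical
  simpa using (weightedHomogeneousComponent_of_mem (isWeightedHomogeneous_X F w i) :
    weightedHomogeneousComponent w (w i) (X i : MvPolynomial σ F) = _)

section Substitution

variable {F : Type*} [Field F]

theorem totalDegree_pos_of_injective {ψ : MvPolynomial (Fin 2) F →ₐ[F] MvPolynomial (Fin 2) F}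
    (hψ : Function.Injective ψ) (i : Fin 2) : 0 < (ψ (X i)).totalDegree := by
  by_contra h
  have h0 : (ψ (X i)).totalDegree = 0 := by omega
  rw [totalDegree_eq_zero_iff_eq_C] at h0
  have h1 : (X i : MvPolynomial (Fin 2) F) = C (coeff 0 (ψ (X i))) :=
    hψ (by rw [h0, ← algebraMap_eq, AlgHom.commutes, algebraMap_eq, coeff_C, if_pos rfl])
  have := congrArg totalDegree h1
  rw [totalDegree_X, totalDegree_C] at this
  exact one_ne_zero this

theorem aeval_eq_algEquiv (φ : MvPolynomial (Fin 2) F ≃ₐ[F] MvPolynomial (Fin 2) F)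
    (p : MvPolynomial (Fin 2) F) : aeval ![φ (X 0), φ (X 1)] p = φ p := by
  have : aeval ![φ (X 0), φ (X 1)] = (φ : MvPolynomial (Fin 2) F →ₐ[F] MvPolynomial (Fin 2) F) := by
    ext i : 1
    fin_cases i <;> simp
  rw [this]; rfl

/-- The leading forms of `φ x` and `φ y` satisfy the leading part of a relation expressing one of
the variables. -/
theorem leadingForm_relation (φ : MvPolynomial (Fin 2) F ≃ₐ[F] MvPolynomial (Fin 2) F) (i : Fin 2)
    {N : ℚ} (hN : 1 < N)
    (hR : WeightLE ![((φ (X 0)).totalDegree : ℚ), ((φ (X 1)).totalDegree : ℚ)] N (φ.symm (X i))) :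
    aeval ![leadingForm (φ (X 0)), leadingForm (φ (X 1))]
      (weightedHomogeneousComponent
        ![((φ (X 0)).totalDegree : ℚ), ((φ (X 1)).totalDegree : ℚ)] N (φ.symm (X i))) = 0 := by
  have h := WeightLE.aeval (w := fun _ : Fin 2 => (1 : ℚ)) (p := ![φ (X 0), φ (X 1)])
    (by intro j; fin_cases j <;> exact weightLE_one_iff.mpr le_rfl) hR
  rw [aeval_eq_algEquiv, AlgEquiv.apply_symm_apply,
    (weightLE_X (fun _ : Fin 2 => (1 : ℚ)) i).component_eq_zero hN] at h
  rw [h.2]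
  congr 2
  ext j : 1
  fin_cases j <;> rfl

/-- The specialization `T = 0` of `F[T, u, v]`. -/
noncomputable def specializeZero (F : Type*) [Field F] :
    MvPolynomial (Fin 3) F →ₐ[F] MvPolynomial (Fin 2) F :=
  aeval ![0, X 0, X 1]

theorem aeval_X_one_X_two (p : MvPolynomial (Fin 2) F) :
    aeval ![X 1, X 2] p = rename (Fin.succ : Fin 2 → Fin 3) p := by
  rw [rename_eq_aeval]
  congr 2
  ext j : 1
  fin_cases j <;> rfl

theorem specializeZero_rename (p : MvPolynomial (Fin 2) F) :
    specializeZero F (rename (Fin.succ : Fin 2 → Fin 3) p) = p := by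
  rw [specializeZero, aeval_rename]
  have : (![0, X 0, X 1] ∘ (Fin.succ : Fin 2 → Fin 3) : Fin 2 → MvPolynomial (Fin 2) F) = X := by
    ext j : 1
    fin_cases j <;> rfl
  rw [this, aeval_X_left_apply]

theorem exists_eq_rename_add_X_mul (p : MvPolynomial (Fin 3) F) :
    ∃ Q, p = rename (Fin.succ : Fin 2 → Fin 3) (specializeZero F p) + X 0 * Q := by
  induction p using MvPolynomial.induction_on with
  | C c => exact ⟨0, by simp [specializeZero]⟩
  | add p q hp hq =>
    obtain ⟨P, hP⟩ := hp
    obtain ⟨Q, hQ⟩ := hq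
    refine ⟨P + Q, ?_⟩
    rw [map_add, map_add, mul_add]
    linear_combination hP + hQ
  | mul_X p i hp =>
    obtain ⟨P, hP⟩ := hp
    refine Fin.cases ⟨p, ?_⟩ (fun j => ⟨P * X j.succ, ?_⟩) i
    · simp [specializeZero, mul_comm]
    · have : specializeZero F (X j.succ) = X j := by
        fin_cases j <;> simp [specializeZero]
      rw [map_mul, this, map_mul, rename_X]
      linear_combination X j.succ * hP

theorem eq_rename_of_degreeOf_eq_zero {p : MvPolynomial (Fin 3) F} (hp : degreeOf 0 p = 0) :
    p = rename (Fin.succ : Fin 2 → Fin 3) (specializeZero F p) := by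
  obtain ⟨Q, hQ⟩ := exists_eq_rename_add_X_mul p
  ext d
  by_cases hd : d 0 = 0
  · conv_lhs => rw [hQ]
    rw [coeff_add, coeff_X_mul', if_neg (by simp [hd]), add_zero]
  · have h1 : coeff d p = 0 := by
      by_contra h
      have := monomial_le_degreeOf 0 (mem_support_iff.mpr h)
      omega
    rw [h1]
    by_contra h
    obtain ⟨u, rfl, -⟩ := coeff_rename_ne_zero _ _ _ (Ne.symm h)
    refine hd ?_
    rw [Finsupp.mapDomain_of_notMem_range]
    rintro ⟨x, hx⟩
    exact absurd hx (Fin.succ_ne_zero x)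

theorem degreeOf_zero_rename_succ (p : MvPolynomial (Fin 2) F) :
    degreeOf 0 (rename (Fin.succ : Fin 2 → Fin 3) p) = 0 := by
  rw [← Nat.le_zero, degreeOf_le_iff]
  intro d hd
  obtain ⟨u, rfl, -⟩ := coeff_rename_ne_zero _ _ _ (mem_support_iff.mp hd)
  rw [Finsupp.mapDomain_of_notMem_range]
  rintro ⟨x, hx⟩
  exact absurd hx (Fin.succ_ne_zero x)

end Substitution

/-! ### Degree reduction for automorphisms of the plane -/

section Reduction

variable {F : Type*} [Field F]

theorem weight_fin_three (w : Fin 3 → ℚ) (d : Fin 3 →₀ ℕ) :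
    Finsupp.weight w d = d 0 * w 0 + d 1 * w 1 + d 2 * w 2 := by
  rw [Finsupp.weight_apply, Finsupp.sum_fintype _ _ (by simp), Fin.sum_univ_three]
  simp

/-- Given weights `a`, `b` of `u`, `v`, the weight `t` of `T` can be chosen such that the forms of
weights `a` and `b` of `U = u + T(⋯)` and `V = v + T(⋯)` are their leading forms and one of
these still involves `T`. -/
theorem exists_weight {U V : MvPolynomial (Fin 3) F} (a b : ℚ) (hU : specializeZero F U = X 0)
    (hV : specializeZero F V = X 1) (hUV : ¬ (degreeOf 0 U = 0 ∧ degreeOf 0 V = 0)) :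
    ∃ t : ℚ, WeightLE ![t, a, b] a U ∧ WeightLE ![t, a, b] b V ∧
      ¬ (degreeOf 0 (weightedHomogeneousComponent ![t, a, b] a U) = 0 ∧
        degreeOf 0 (weightedHomogeneousComponent ![t, a, b] b V) = 0) := by
  classical
  have key : ∀ (W : MvPolynomial (Fin 3) F) (i : Fin 2), specializeZero F W = X i →
      ∀ d ∈ W.support, d 0 = 0 → d = Finsupp.single i.succ 1 := by
    intro W i hW d hd h0
    obtain ⟨Q, hQ⟩ := exists_eq_rename_add_X_mul W
    rw [mem_support_iff, hQ, coeff_add, coeff_X_mul', if_neg (by simp [h0]), add_zero, hW,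
      rename_X, coeff_X] at hd
    by_contra hne
    exact hd (if_neg (Ne.symm hne))
  let s : MvPolynomial (Fin 3) F → ℚ → Finset ℚ := fun W e =>
    (W.support.filter fun d => 0 < d 0).image fun d => (e - (d 1 * a + d 2 * b)) / d 0
  have hs : (s U a ∪ s V b).Nonempty := by
    have ex : ∀ (W : MvPolynomial (Fin 3) F) (e : ℚ), degreeOf 0 W ≠ 0 → (s W e).Nonempty := by
      intro W e hW
      rw [← Nat.pos_iff_ne_zero, ← not_le, degreeOf_le_iff] at hW
      push Not at hW
      obtain ⟨d, hd, hd0⟩ := hW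
      exact ⟨_, Finset.mem_image_of_mem _ (Finset.mem_filter.mpr ⟨hd, hd0⟩)⟩
    by_cases h : degreeOf 0 U = 0
    · exact (ex V b fun h' => hUV ⟨h, h'⟩).mono Finset.subset_union_right
    · exact (ex U a h).mono Finset.subset_union_left
  set t := (s U a ∪ s V b).min' hs with ht
  have hle : ∀ (W : MvPolynomial (Fin 3) F) (e : ℚ) (i : Fin 2), specializeZero F W = X i →
      e = ![t, a, b] i.succ → (∀ x ∈ s W e, t ≤ x) → WeightLE ![t, a, b] e W := by
    intro W e i hW he hx d hd
    rcases Nat.eq_zero_or_pos (d 0) with h0 | h0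
    · rw [key W i hW d hd h0, Finsupp.weight_single, one_smul, he]
    · have h1 := hx _ (Finset.mem_image_of_mem _ (Finset.mem_filter.mpr ⟨hd, h0⟩))
      rw [le_div_iff₀ (by exact_mod_cast h0)] at h1
      rw [weight_fin_three]
      simp only [Matrix.cons_val_zero, Matrix.cons_val_one, Matrix.cons_val]
      linarith
  have hattain : ∀ (W : MvPolynomial (Fin 3) F) (e : ℚ), t ∈ s W e →
      degreeOf 0 (weightedHomogeneousComponent ![t, a, b] e W) ≠ 0 := by
    intro W e hmem
    obtain ⟨d, hd, hdt⟩ := Finset.mem_image.mp hmem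
    obtain ⟨hd, h0⟩ := Finset.mem_filter.mp hd
    rw [div_eq_iff (by exact_mod_cast h0.ne')] at hdt
    have hw : Finsupp.weight ![t, a, b] d = e := by
      rw [weight_fin_three]
      simp only [Matrix.cons_val_zero, Matrix.cons_val_one, Matrix.cons_val]
      linarith
    have hmem' : d ∈ (weightedHomogeneousComponent ![t, a, b] e W).support := by
      rw [mem_support_iff, coeff_weightedHomogeneousComponent, if_pos hw]
      exact mem_support_iff.mp hd
    have := monomial_le_degreeOf 0 hmem'
    omega
  refine ⟨t, hle U a 0 hU rfl fun x hx => Finset.min'_le _ _ (Finset.mem_union_left _ hx),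
    hle V b 1 hV rfl fun x hx => Finset.min'_le _ _ (Finset.mem_union_right _ hx), fun h => ?_⟩
  rcases Finset.mem_union.mp (Finset.min'_mem _ hs) with h' | h'
  · exact hattain U a h' h.1
  · exact hattain V b h' h.2

/-- The translation `ψ x ↦ ψ x`, `ψ y ↦ ψ y + T`, where `ψ` is the inverse of `φ`, given by
polynomials `U`, `V` in `T, u, v` that reduce to `u`, `v` for `T = 0`. -/
theorem exists_translation (φ : MvPolynomial (Fin 2) F ≃ₐ[F] MvPolynomial (Fin 2) F) :
    ∃ U V : MvPolynomial (Fin 3) F, specializeZero F U = X 0 ∧ specializeZero F V = X 1 ∧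
      aeval ![U, V] (φ.symm (X 0)) = aeval ![X 1, X 2] (φ.symm (X 0)) ∧
      ¬ (degreeOf 0 U = 0 ∧ degreeOf 0 V = 0) := by
  let ι : MvPolynomial (Fin 2) F →ₐ[F] MvPolynomial (Fin 3) F := rename Fin.succ
  let η : MvPolynomial (Fin 2) F →ₐ[F] MvPolynomial (Fin 3) F :=
    aeval ![ι (φ.symm (X 0)), ι (φ.symm (X 1)) + X 0]
  have hη : ∀ p, aeval ![η (φ (X 0)), η (φ (X 1))] p = η (φ p) := by
    intro p
    have : aeval ![η (φ (X 0)), η (φ (X 1))] =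
        η.comp (φ : MvPolynomial (Fin 2) F →ₐ[F] MvPolynomial (Fin 2) F) := by
      ext i : 1
      fin_cases i <;> simp
    rw [this]; rfl
  have hsp : ∀ p, specializeZero F (η p) = φ.symm p := by
    intro p
    have : (specializeZero F).comp η =
        (φ.symm : MvPolynomial (Fin 2) F →ₐ[F] MvPolynomial (Fin 2) F) := by
      ext i : 1
      have hz : specializeZero F (X 0) = 0 := by simp [specializeZero]
      fin_cases i <;> simp [η, ι, specializeZero_rename, hz]
    exact DFunLike.congr_fun this p
  have hU : specializeZero F (η (φ (X 0))) = X 0 := by rw [hsp, AlgEquiv.symm_apply_apply]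
  have hV : specializeZero F (η (φ (X 1))) = X 1 := by rw [hsp, AlgEquiv.symm_apply_apply]
  refine ⟨η (φ (X 0)), η (φ (X 1)), hU, hV, ?_, ?_⟩
  · rw [hη, AlgEquiv.apply_symm_apply, aeval_X_one_X_two]
    simp [η, ι]
  · rintro ⟨h0, h1⟩
    have e0 := eq_rename_of_degreeOf_eq_zero h0
    have e1 := eq_rename_of_degreeOf_eq_zero h1
    rw [hU, rename_X] at e0
    rw [hV, rename_X] at e1
    have h2 := hη (φ.symm (X 1))
    rw [AlgEquiv.apply_symm_apply, e0, e1] at h2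
    have h3 : η (X 1) = ι (φ.symm (X 1)) + X 0 := by simp [η]
    rw [h3] at h2
    have h4 : aeval ![X (Fin.succ 0), X (Fin.succ 1)] (φ.symm (X 1)) = ι (φ.symm (X 1)) :=
      aeval_X_one_X_two _
    rw [h4] at h2
    exact X_ne_zero (R := F) (0 : Fin 3) (by linear_combination -h2)

/-- The exponents in the proportionality of powers of the two leading forms cannot both exceed
`1`: otherwise the leading form of a translation would parametrize a cuspidal curve. -/
theorem exponent_eq_one (φ : MvPolynomial (Fin 2) F ≃ₐ[F] MvPolynomial (Fin 2) F) {e k l : ℕ}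
    (he : 0 < e) (hk : 2 ≤ k) (hl : 2 ≤ l) (hkl : k.Coprime l)
    (hf : (φ (X 0)).totalDegree = e * k) (hg : (φ (X 1)).totalDegree = e * l) {c : F}
    (hc : c ≠ 0) (hfg : leadingForm (φ (X 0)) ^ l = C c * leadingForm (φ (X 1)) ^ k) : False := by
  classical
  have hf0 : 0 < (φ (X 0)).totalDegree := by rw [hf]; positivity
  have hg0 : 0 < (φ (X 1)).totalDegree := by rw [hg]; positivity
  set a : ℚ := ((φ (X 0)).totalDegree : ℚ) with ha
  set b : ℚ := ((φ (X 1)).totalDegree : ℚ) with hb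
  have ha2 : 2 ≤ a := by
    rw [ha, hf]; exact_mod_cast hk.trans (Nat.le_mul_of_pos_left _ he)
  have hb2 : 2 ≤ b := by
    rw [hb, hg]; exact_mod_cast hl.trans (Nat.le_mul_of_pos_left _ he)
  set P := φ.symm (X 0) with hP
  have hPpos : 0 < P.totalDegree :=
    totalDegree_pos_of_injective (ψ := (φ.symm : MvPolynomial (Fin 2) F →ₐ[F] _)) φ.symm.injective 0
  have hP0 : P ≠ 0 := fun h => by simp [h] at hPpos
  obtain ⟨N, hN, hN0⟩ := exists_top_component ![a, b] hP0
  have hN1 : 1 < N := by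
    by_contra hle
    refine hPpos.ne' ?_
    rw [← Nat.le_zero, totalDegree, Finset.sup_le_iff]
    intro d hd
    have h1 := hN d hd
    rw [weight_fin_two] at h1
    simp only [Matrix.cons_val_zero, Matrix.cons_val_one] at h1
    rw [Finsupp.sum_fintype _ _ (by simp), Fin.sum_univ_two]
    by_contra h2
    have h3 : (1 : ℚ) ≤ d 0 + d 1 := by exact_mod_cast (by omega : 1 ≤ d 0 + d 1)
    nlinarith [(Nat.cast_nonneg (d 0) : (0 : ℚ) ≤ d 0), (Nat.cast_nonneg (d 1) : (0 : ℚ) ≤ d 1)]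
  have hrel := leadingForm_relation φ 0 hN1 hN
  set R := weightedHomogeneousComponent ![a, b] N P with hR
  have hRw : IsWeightedHomogeneous ![((e * k : ℕ) : ℚ), ((e * l : ℕ) : ℚ)] R N := by
    rw [← hf, ← hg]
    exact weightedHomogeneousComponent_isWeightedHomogeneous N _
  obtain ⟨Q, hQ⟩ := binomial_dvd he (by omega) hkl hRw (leadingForm_ne_zero hf0)
    (leadingForm_ne_zero hg0) hfg hrel
  obtain ⟨U, V, hU, hV, hUV, hT⟩ := exists_translation φ
  obtain ⟨t, htU, htV, htT⟩ := exists_weight a b hU hV hT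
  set w : Fin 3 → ℚ := ![t, a, b] with hw
  set U' := weightedHomogeneousComponent w a U with hU'
  set V' := weightedHomogeneousComponent w b V with hV'
  -- the leading form of `P(U, V) = P(u, v)`
  have hinv : aeval ![U', V'] R = aeval ![X 1, X 2] R := by
    have h1 := (WeightLE.aeval (w := w) (p := ![U, V])
      (by intro j; fin_cases j <;> assumption) hN).2
    have h2 := (WeightLE.aeval (w := w) (p := ![X 1, X 2])
      (by intro j; fin_cases j <;> exact weightLE_X w _) hN).2
    rw [hUV, h2] at h1
    refine Eq.trans ?_ (h1.symm.trans ?_)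
    · congr 2; ext j : 1; fin_cases j <;> rfl
    · congr 2; ext j : 1; fin_cases j
      · exact component_X w 1
      · exact component_X w 2
  -- specialization at `T = 0` commutes with taking leading forms
  have hsp : ∀ (W : MvPolynomial (Fin 3) F) (x : ℚ), WeightLE w x W →
      specializeZero F (weightedHomogeneousComponent w x W) =
        weightedHomogeneousComponent ![a, b] x (specializeZero F W) := by
    intro W x hx
    have h0 : WeightLE ![a, b] t (0 : MvPolynomial (Fin 2) F) := by intro d hd; simp at hd
    have h1 := (WeightLE.aeval (w := ![a, b]) (a := w) (p := ![(0 : MvPolynomial (Fin 2) F), X 0, X 1])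
      (by intro j; fin_cases j
          · exact h0
          · exact weightLE_X ![a, b] 0
          · exact weightLE_X ![a, b] 1) hx).2
    rw [specializeZero, h1]
    congr 2; ext j : 1; fin_cases j
    · exact (map_zero _).symm
    · exact (component_X ![a, b] 0).symm
    · exact (component_X ![a, b] 1).symm
  have hspU : specializeZero F U' = X 0 := by
    rw [hU', hsp U a htU, hU]; exact component_X ![a, b] 0
  have hspV : specializeZero F V' = X 1 := by
    rw [hV', hsp V b htV, hV]; exact component_X ![a, b] 1
  have hdvd : U' ^ l - C c * V' ^ k ∣ aeval ![X 1, X 2] R := by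
    refine ⟨aeval ![U', V'] Q, ?_⟩
    rw [← hinv, hQ, map_mul]
    simp [algebraMap_eq]
  have hR3 : (aeval ![X 1, X 2] R : MvPolynomial (Fin 3) F) ≠ 0 := by
    rw [aeval_X_one_X_two, Ne, map_eq_zero_iff _ (rename_injective _ (Fin.succ_injective _))]
    exact hN0
  have hcusp0 : degreeOf 0 (U' ^ l - C c * V' ^ k) = 0 := by
    obtain ⟨S, hS⟩ := hdvd
    have h1 := congrArg (degreeOf 0) hS
    rw [hS] at hR3
    rw [degreeOf_mul_eq (left_ne_zero_of_mul hR3) (right_ne_zero_of_mul hR3), aeval_X_one_X_two,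
      degreeOf_zero_rename_succ] at h1
    omega
  have hcusp : U' ^ l - C c * V' ^ k = X 1 ^ l - C c * X 2 ^ k := by
    rw [eq_rename_of_degreeOf_eq_zero hcusp0]
    have hC : ∀ y : F, specializeZero F (C y) = C y := fun y => by simp [specializeZero]
    simp only [map_sub, map_mul, map_pow, hspU, hspV, hC, rename_X, rename_C]
    rfl
  have hU0 : U' ≠ 0 := fun h => X_ne_zero (R := F) (0 : Fin 2) (by rw [← hspU, h, map_zero])
  have hV0 : V' ≠ 0 := fun h => X_ne_zero (R := F) (1 : Fin 2) (by rw [← hspV, h, map_zero])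
  exact htT (cusp_rigid hl hk hkl.symm hc hU0 hV0 hcusp)

/-- If an automorphism `(f, g)` has degree `deg f ≥ 2`, and `deg f ≥ deg g`, then subtracting a
multiple of a power of `g` lowers the degree of `f`. -/
theorem exists_totalDegree_sub_lt (φ : MvPolynomial (Fin 2) F ≃ₐ[F] MvPolynomial (Fin 2) F)
    (hle : (φ (X 1)).totalDegree ≤ (φ (X 0)).totalDegree) (h2 : 2 ≤ (φ (X 0)).totalDegree) :
    ∃ (k : ℕ) (c : F), (φ (X 0)).totalDegree = k * (φ (X 1)).totalDegree ∧
      (φ (X 0) - C c * φ (X 1) ^ k).totalDegree < (φ (X 0)).totalDegree := by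
  classical
  have hg0 : 0 < (φ (X 1)).totalDegree :=
    totalDegree_pos_of_injective (ψ := (φ : MvPolynomial (Fin 2) F →ₐ[F] _)) φ.injective 1
  have hf0 : 0 < (φ (X 0)).totalDegree := by omega
  -- one of the components of the inverse has weight greater than `1`
  obtain ⟨i, N, hN1, hN, hN0⟩ : ∃ (i : Fin 2) (N : ℚ), 1 < N ∧
      WeightLE ![((φ (X 0)).totalDegree : ℚ), ((φ (X 1)).totalDegree : ℚ)] N (φ.symm (X i)) ∧
      weightedHomogeneousComponent ![((φ (X 0)).totalDegree : ℚ), ((φ (X 1)).totalDegree : ℚ)] N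
        (φ.symm (X i)) ≠ 0 := by
    by_contra! hno
    have hfix : ∀ i, aeval ![0, X 1] (φ.symm (X i)) = φ.symm (X i) := by
      intro i
      have hne : φ.symm (X i) ≠ 0 := by
        rw [Ne, map_eq_zero_iff _ φ.symm.injective]; exact X_ne_zero i
      obtain ⟨N, hN, hN0⟩ := exists_top_component
        ![((φ (X 0)).totalDegree : ℚ), ((φ (X 1)).totalDegree : ℚ)] hne
      have hN1 : N ≤ 1 := not_lt.mp fun h => hN0 (hno i N h hN)
      conv_rhs => rw [← aeval_X_left_apply (φ.symm (X i))]
      rw [aeval_def, aeval_def, eval₂_eq', eval₂_eq']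
      refine Finset.sum_congr rfl fun d hd => ?_
      have h1 := (hN d hd).trans hN1
      rw [weight_fin_two] at h1
      simp only [Matrix.cons_val_zero, Matrix.cons_val_one] at h1
      have h3 : d 0 * (φ (X 0)).totalDegree + d 1 * (φ (X 1)).totalDegree ≤ 1 := by
        exact_mod_cast h1
      have h4 : d 0 = 0 := by
        by_contra h
        have := Nat.mul_le_mul (Nat.pos_of_ne_zero h) h2
        omega
      simp [Fin.prod_univ_two, h4]
    have h1 : aeval ![0, X 1] (aeval ![φ.symm (X 0), φ.symm (X 1)] (φ (X 0))) =
        aeval ![φ.symm (X 0), φ.symm (X 1)] (φ (X 0)) := by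
      rw [comp_aeval_apply]
      congr 2
      ext j : 1
      fin_cases j <;> exact hfix _
    rw [aeval_eq_algEquiv φ.symm, AlgEquiv.symm_apply_apply, aeval_X] at h1
    exact X_ne_zero (R := F) (0 : Fin 2) h1.symm
  have hrel := leadingForm_relation φ i hN1 hN
  set m := (φ (X 0)).totalDegree with hm
  set n := (φ (X 1)).totalDegree with hn
  have he : 0 < m.gcd n := Nat.gcd_pos_of_pos_left _ hf0
  obtain ⟨k, hk⟩ := Nat.gcd_dvd_left m n
  obtain ⟨l, hl⟩ := Nat.gcd_dvd_right m n
  have hkl : k.Coprime l := by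
    have h3 : m.gcd n * k.gcd l = m.gcd n * 1 := by
      rw [← Nat.gcd_mul_left, ← hk, ← hl, mul_one]
    exact Nat.eq_of_mul_eq_mul_left he h3
  set e := m.gcd n
  have hl0 : 0 < l := Nat.pos_of_ne_zero fun h => by rw [h, mul_zero] at hl; omega
  have hlk : l ≤ k := by
    rw [hk, hl] at hle
    exact Nat.le_of_mul_le_mul_left hle he
  have hRw : IsWeightedHomogeneous ![((e * k : ℕ) : ℚ), ((e * l : ℕ) : ℚ)]
      (weightedHomogeneousComponent ![(m : ℚ), (n : ℚ)] N (φ.symm (X i))) N := by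
    rw [← hk, ← hl]
    exact weightedHomogeneousComponent_isWeightedHomogeneous N _
  obtain ⟨c, hc, hfg⟩ := exists_pow_eq_C_mul_pow he hl0 hkl hN0 hRw (leadingForm_ne_zero hf0)
    (leadingForm_ne_zero hg0) ((totalDegree_leadingForm hf0).trans hk)
    ((totalDegree_leadingForm hg0).trans hl) hrel
  have hl1 : l = 1 := by
    by_contra hne
    exact exponent_eq_one φ he (by omega) (by omega) hkl hk hl hc hfg
  have hen : e = n := by rw [hl, hl1, mul_one]
  have hmk : m = k * n := by rw [hk, hen, mul_comm]
  rw [hl1, pow_one] at hfg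
  refine ⟨k, c, hmk, totalDegree_lt_of_component_eq_zero hf0 ?_ ?_⟩
  · refine (totalDegree_sub _ _).trans (max_le le_rfl ?_)
    refine (totalDegree_mul _ _).trans ?_
    rw [totalDegree_C, totalDegree_pow_eq, zero_add, ← hn, ← hmk]
  · have h3 := ((weightLE_one_iff.mpr le_rfl : WeightLE (fun _ => 1) (n : ℚ) (φ (X 1))).pow k).2
    have h4 : ((m : ℕ) : ℚ) = (k : ℚ) * n := by rw [hmk]; push_cast; rfl
    rw [map_sub, weightedHomogeneousComponent_C_mul, sub_eq_zero, h4, h3, ← h4]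
    exact hfg

end Reduction

/-! ### Elementary automorphisms and the normal form -/

section Shear

variable {F : Type*} [Field F]

theorem totalDegree_aeval {f : MvPolynomial (Fin 2) F} (hf : 0 < f.totalDegree)
    (P : Polynomial F) : (Polynomial.aeval f P).totalDegree = P.natDegree * f.totalDegree := by
  induction h : P.natDegree using Nat.strong_induction_on generalizing P with
  | _ n ih =>
    rcases Nat.eq_zero_or_pos n with rfl | hn
    · rw [Polynomial.eq_C_of_natDegree_eq_zero h, Polynomial.aeval_C, algebraMap_eq, totalDegree_C,
        zero_mul]
    have hlead : P.leadingCoeff ≠ 0 := fun h0 => by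
      rw [Polynomial.leadingCoeff_eq_zero] at h0
      rw [h0, Polynomial.natDegree_zero] at h
      omega
    have hf0 : f ≠ 0 := fun h0 => by simp [h0] at hf
    have h1 : (Polynomial.aeval f (Polynomial.monomial P.natDegree P.leadingCoeff)).totalDegree =
        n * f.totalDegree := by
      rw [Polynomial.aeval_monomial, algebraMap_eq, totalDegree_mul_of_isDomain
        (C_eq_zero.not.mpr hlead) (pow_ne_zero _ hf0), totalDegree_C, totalDegree_pow_eq, h, zero_add]
    have h2 : (Polynomial.aeval f P.eraseLead).totalDegree < n * f.totalDegree := by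
      have h3 : P.eraseLead.natDegree < n := by
        have := P.eraseLead_natDegree_le
        omega
      rw [ih _ h3 _ rfl]
      exact Nat.mul_lt_mul_of_pos_right h3 hf
    rw [← P.eraseLead_add_monomial_natDegree_leadingCoeff, map_add,
      totalDegree_add_eq_right_of_totalDegree_lt (by rw [h1]; exact h2), h1]

theorem totalDegree_apply_X_pos (φ : MvPolynomial (Fin 2) F ≃ₐ[F] MvPolynomial (Fin 2) F)
    (i : Fin 2) : 0 < (φ (X i)).totalDegree :=
  totalDegree_pos_of_injective (ψ := (φ : MvPolynomial (Fin 2) F →ₐ[F] _)) φ.injective i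

theorem algEquiv_ext_fin_two {φ ψ : MvPolynomial (Fin 2) F ≃ₐ[F] MvPolynomial (Fin 2) F}
    (h0 : φ (X 0) = ψ (X 0)) (h1 : φ (X 1) = ψ (X 1)) : φ = ψ := by
  ext1 p
  rw [← aeval_eq_algEquiv φ, ← aeval_eq_algEquiv ψ, h0, h1]

/-- The automorphism `x ↦ y + P(x)`, `y ↦ x`. For `P = 0` it swaps the variables. -/
noncomputable def shear (P : Polynomial F) :
    MvPolynomial (Fin 2) F ≃ₐ[F] MvPolynomial (Fin 2) F :=
  AlgEquiv.ofAlgHom (aeval ![X 1 + Polynomial.aeval (X 0) P, X 0])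
    (aeval ![X 1, X 0 - Polynomial.aeval (X 1) P])
    (by
      ext i : 1
      fin_cases i
      · simp
      · simp [← Polynomial.aeval_algHom_apply])
    (by
      ext i : 1
      fin_cases i
      · simp [← Polynomial.aeval_algHom_apply]
      · simp)

variable (φ : MvPolynomial (Fin 2) F ≃ₐ[F] MvPolynomial (Fin 2) F) (P : Polynomial F)

theorem shear_trans_X_zero :
    (shear P).trans φ (X 0) = φ (X 1) + Polynomial.aeval (φ (X 0)) P := by
  rw [AlgEquiv.trans_apply, shear, AlgEquiv.ofAlgHom_apply, aeval_X, Matrix.cons_val_zero, map_add,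
    ← AlgEquiv.coe_toAlgHom φ, Polynomial.aeval_algHom_apply]

theorem shear_trans_X_one : (shear P).trans φ (X 1) = φ (X 0) := by
  rw [AlgEquiv.trans_apply, shear, AlgEquiv.ofAlgHom_apply, aeval_X]
  rfl

theorem shear_symm_trans_X_zero : (shear P).symm.trans φ (X 0) = φ (X 1) := by
  rw [AlgEquiv.trans_apply, shear, AlgEquiv.ofAlgHom_symm, AlgEquiv.ofAlgHom_apply, aeval_X]
  rfl

theorem shear_symm_trans_X_one :
    (shear P).symm.trans φ (X 1) = φ (X 0) - Polynomial.aeval (φ (X 1)) P := by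
  rw [AlgEquiv.trans_apply, shear, AlgEquiv.ofAlgHom_symm, AlgEquiv.ofAlgHom_apply, aeval_X,
    Matrix.cons_val_one, Matrix.cons_val_zero, map_sub,
    ← AlgEquiv.coe_toAlgHom φ, Polynomial.aeval_algHom_apply]

theorem shear_zero_trans_X_zero : (shear 0).trans φ (X 0) = φ (X 1) := by
  rw [shear_trans_X_zero, map_zero, add_zero]

/-- Iterating the degree reduction: `φ x` can be reduced modulo polynomials in `φ y` to degree at
most `deg (φ y)`, without using constant and linear terms. -/
theorem exists_reduction : ∃ P : Polynomial F, P.coeff 0 = 0 ∧ P.coeff 1 = 0 ∧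
    (φ (X 0) - Polynomial.aeval (φ (X 1)) P).totalDegree ≤ (φ (X 1)).totalDegree := by
  induction h : (φ (X 0)).totalDegree using Nat.strong_induction_on generalizing φ with
  | _ n ih =>
    rcases le_or_gt n (φ (X 1)).totalDegree with hle | hlt
    · exact ⟨0, by simp, by simp, by simpa [h] using hle⟩
    have hpos := totalDegree_apply_X_pos φ 1
    obtain ⟨k, c, hk, hlt'⟩ := exists_totalDegree_sub_lt φ (by omega) (by omega)
    have hk2 : 2 ≤ k := by
      by_contra hk'
      have : k = 0 ∨ k = 1 := by omega
      rcases this with rfl | rfl <;> omega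
    let Q : Polynomial F := Polynomial.monomial k c
    have hQ : Polynomial.aeval (φ (X 1)) Q = C c * φ (X 1) ^ k := by
      rw [Polynomial.aeval_monomial, algebraMap_eq]
    set ψ := (shear 0).trans ((shear Q).symm.trans φ) with hψ
    have h0 : ψ (X 0) = φ (X 0) - C c * φ (X 1) ^ k := by
      rw [hψ, shear_zero_trans_X_zero, shear_symm_trans_X_one, hQ]
    have h1 : ψ (X 1) = φ (X 1) := by
      rw [hψ, shear_trans_X_one, shear_symm_trans_X_zero]
    obtain ⟨P, hP0, hP1, hP⟩ := ih _ (by rw [← h]; exact hlt') ψ (by rw [h0])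
    refine ⟨P + Q, ?_, ?_, ?_⟩
    · rw [Polynomial.coeff_add, hP0, Polynomial.coeff_monomial, if_neg (by omega), add_zero]
    · rw [Polynomial.coeff_add, hP1, Polynomial.coeff_monomial, if_neg (by omega), add_zero]
    · rw [h0, h1] at hP
      rw [map_add, hQ]
      convert hP using 2
      ring

end Shear

/-! ### Counting automorphisms by their reduction -/

section Counting

variable (F : Type*) [Field F]

/-- The automorphisms `(f, g)` with `deg g ≤ deg f = n`. -/
abbrev WeakDomAut (n : ℕ) : Type _ :=
  {φ : MvPolynomial (Fin 2) F ≃ₐ[F] MvPolynomial (Fin 2) F //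
    (φ (X 0)).totalDegree = n ∧ (φ (X 1)).totalDegree ≤ n}

/-- The automorphisms `(f, g)` with `deg g < deg f = n`. -/
abbrev StrictDomAut (n : ℕ) : Type _ :=
  {φ : MvPolynomial (Fin 2) F ≃ₐ[F] MvPolynomial (Fin 2) F //
    (φ (X 0)).totalDegree = n ∧ (φ (X 1)).totalDegree < n}

/-- The polynomials of degree `k` without constant and linear terms. -/
abbrev ReducedPoly (k : ℕ) : Type _ :=
  {P : Polynomial F // P.natDegree = k ∧ P.coeff 0 = 0 ∧ P.coeff 1 = 0}

instance finite_autDegree_eq [Finite F] (n : ℕ) :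
    Finite {φ : MvPolynomial (Fin 2) F ≃ₐ[F] MvPolynomial (Fin 2) F // autDegree φ = n} := by
  have : Finite (restrictTotalDegree (Fin 2) F n) := Module.finite_of_finite F
  refine Finite.of_injective (β := restrictTotalDegree (Fin 2) F n × restrictTotalDegree (Fin 2) F n)
    (fun φ => (⟨φ.1 (X 0), ?_⟩, ⟨φ.1 (X 1), ?_⟩)) ?_
  · rw [mem_restrictTotalDegree]; exact (le_max_left _ _).trans φ.2.le
  · rw [mem_restrictTotalDegree]; exact (le_max_right _ _).trans φ.2.le
  · intro φ ψ h
    simp only [Prod.mk.injEq, Subtype.mk.injEq] at h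
    exact Subtype.ext (algEquiv_ext_fin_two h.1 h.2)

instance finite_weakDomAut [Finite F] (n : ℕ) : Finite (WeakDomAut F n) :=
  Finite.of_injective (β := {φ : MvPolynomial (Fin 2) F ≃ₐ[F] MvPolynomial (Fin 2) F //
    autDegree φ = n}) (fun φ => ⟨φ.1, by rw [autDegree, φ.2.1]; exact max_eq_left φ.2.2⟩)
    fun _ _ h => Subtype.ext (congrArg Subtype.val h :)

instance finite_strictDomAut [Finite F] (n : ℕ) : Finite (StrictDomAut F n) :=
  Finite.of_injective (β := WeakDomAut F n) (fun φ => ⟨φ.1, φ.2.1, φ.2.2.le⟩)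
    fun _ _ h => Subtype.ext (congrArg Subtype.val h :)

theorem autCount_eq_add [Finite F] (n : ℕ) :
    autCount F n = Nat.card (WeakDomAut F n) + Nat.card (StrictDomAut F n) := by
  rw [autCount, ← Nat.card_sum]
  have hW : ∀ φ : WeakDomAut F n, autDegree φ.1 = n := fun φ => by
    rw [autDegree, φ.2.1]; exact max_eq_left φ.2.2
  have hS : ∀ φ : StrictDomAut F n, autDegree ((shear 0).trans φ.1) = n := fun φ => by
    rw [autDegree, shear_zero_trans_X_zero, shear_trans_X_one, φ.2.1]; exact max_eq_right φ.2.2.le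
  refine (Nat.card_congr (Equiv.ofBijective (Sum.elim
    (fun φ : WeakDomAut F n => (⟨φ.1, hW φ⟩ : {φ // autDegree φ = n}))
    (fun φ : StrictDomAut F n => ⟨(shear 0).trans φ.1, hS φ⟩)) ⟨?_, ?_⟩)).symm
  · have aux : ∀ (φ : WeakDomAut F n) (ψ : StrictDomAut F n), φ.1 ≠ (shear 0).trans ψ.1 := by
      intro φ ψ h
      have := φ.2.1
      rw [h, shear_zero_trans_X_zero] at this
      exact ψ.2.2.ne this
    rintro (φ | φ) (ψ | ψ) h
    · exact congrArg Sum.inl (Subtype.ext (congrArg Subtype.val h :))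
    · exact absurd (congrArg Subtype.val h) (aux φ ψ)
    · exact absurd (congrArg Subtype.val h).symm (aux ψ φ)
    · have h' : (shear 0).trans φ.1 = (shear 0).trans ψ.1 := congrArg Subtype.val h
      refine congrArg Sum.inr (Subtype.ext (algEquiv_ext_fin_two ?_ ?_))
      · rw [← shear_trans_X_one φ.1 0, h', shear_trans_X_one]
      · rw [← shear_zero_trans_X_zero φ.1, h', shear_zero_trans_X_zero]
  · rintro ⟨φ, hφ⟩
    rw [autDegree] at hφ
    rcases le_or_gt (φ (X 1)).totalDegree (φ (X 0)).totalDegree with h | h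
    · rw [max_eq_left h] at hφ
      exact ⟨Sum.inl ⟨φ, hφ, hφ ▸ h⟩, rfl⟩
    · rw [max_eq_right h.le] at hφ
      refine ⟨Sum.inr ⟨(shear 0).trans φ, ?_, ?_⟩, Subtype.ext (algEquiv_ext_fin_two ?_ ?_)⟩
      · rw [shear_zero_trans_X_zero, hφ]
      · rw [shear_trans_X_one, ← hφ]; exact h
      · exact (shear_zero_trans_X_zero _).trans (shear_trans_X_one _ _)
      · exact (shear_trans_X_one _ _).trans (shear_zero_trans_X_zero _)

/-- An automorphism `(f, g)` with `deg g ≤ deg f = n` and `n ≥ 2` is uniquely `(f, g' + c f)` with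
`deg g' < n`. -/
theorem card_weakDomAut {n : ℕ} (hn : 2 ≤ n) :
    Nat.card (WeakDomAut F n) = Nat.card F * Nat.card (StrictDomAut F n) := by
  rw [mul_comm, ← Nat.card_prod]
  let T : (MvPolynomial (Fin 2) F ≃ₐ[F] MvPolynomial (Fin 2) F) → F →
      (MvPolynomial (Fin 2) F ≃ₐ[F] MvPolynomial (Fin 2) F) := fun φ c =>
    (shear 0).trans ((shear (Polynomial.C c * Polynomial.X)).trans φ)
  have hT0 : ∀ φ c, T φ c (X 0) = φ (X 0) := fun φ c => by
    rw [shear_zero_trans_X_zero, shear_trans_X_one]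
  have hT1 : ∀ φ c, T φ c (X 1) = φ (X 1) + C c * φ (X 0) := fun φ c => by
    rw [shear_trans_X_one, shear_trans_X_zero, map_mul, Polynomial.aeval_C, Polynomial.aeval_X,
      algebraMap_eq]
  have hdeg : ∀ (c : F) (f : MvPolynomial (Fin 2) F), (C c * f).totalDegree ≤ f.totalDegree := by
    intro c f
    simpa using totalDegree_mul (C c) f
  refine (Nat.card_congr (Equiv.ofBijective (fun x : StrictDomAut F n × F =>
    (⟨T x.1.1 x.2, ?_, ?_⟩ : WeakDomAut F n)) ⟨?_, ?_⟩)).symm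
  · rw [hT0, x.1.2.1]
  · rw [hT1]
    exact (totalDegree_add _ _).trans
      (max_le x.1.2.2.le ((hdeg _ _).trans x.1.2.1.le))
  · rintro ⟨φ, c⟩ ⟨ψ, d⟩ h
    have h' : T φ.1 c = T ψ.1 d := congrArg Subtype.val h
    have h0 : φ.1 (X 0) = ψ.1 (X 0) := by rw [← hT0 φ.1 c, h', hT0]
    have h1 : φ.1 (X 1) + C c * φ.1 (X 0) = ψ.1 (X 1) + C d * ψ.1 (X 0) := by
      rw [← hT1 φ.1 c, h', hT1]
    have hcd : c = d := by
      by_contra hne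
      have h2 : φ.1 (X 1) - ψ.1 (X 1) = C (d - c) * ψ.1 (X 0) := by
        rw [h0] at h1
        rw [C_sub]
        linear_combination h1
      have h3 := congrArg totalDegree h2
      have hψ0 : ψ.1 (X 0) ≠ 0 := fun h => by
        have := totalDegree_apply_X_pos ψ.1 0
        simp [h] at this
      rw [totalDegree_mul_of_isDomain (C_eq_zero.not.mpr (sub_ne_zero.mpr (Ne.symm hne))) hψ0,
        totalDegree_C, zero_add, ψ.2.1] at h3
      have h4 := totalDegree_sub (φ.1 (X 1)) (ψ.1 (X 1))
      have h5 := max_lt φ.2.2 ψ.2.2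
      omega
    subst hcd
    rw [h0, add_left_inj] at h1
    rw [Subtype.ext (algEquiv_ext_fin_two h0 h1)]
  · rintro ⟨φ, hφ0, hφ1⟩
    obtain ⟨c, hc⟩ : ∃ c : F, (φ (X 1) - C c * φ (X 0)).totalDegree < n := by
      rcases lt_or_eq_of_le hφ1 with hlt | heq
      · exact ⟨0, by simpa using hlt⟩
      · obtain ⟨k, c, hk, hc⟩ := exists_totalDegree_sub_lt ((shear 0).trans φ)
          (by rw [shear_trans_X_one, shear_zero_trans_X_zero]; omega)
          (by rw [shear_zero_trans_X_zero]; omega)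
        rw [shear_trans_X_one, shear_zero_trans_X_zero] at hc hk
        have hk1 : k = 1 := by
          rw [heq, hφ0] at hk
          exact Nat.eq_of_mul_eq_mul_right (by omega : 0 < n) (by rw [one_mul]; exact hk.symm)
        rw [hk1, pow_one, heq] at hc
        exact ⟨c, hc⟩
    refine ⟨(⟨T φ (-c), ?_, ?_⟩, c), Subtype.ext (algEquiv_ext_fin_two ?_ ?_)⟩
    · rw [hT0, hφ0]
    · rw [hT1, C_neg, neg_mul, ← sub_eq_add_neg]; exact hc
    · change T (T φ (-c)) c (X 0) = φ (X 0)
      rw [hT0, hT0]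
    · change T (T φ (-c)) c (X 1) = φ (X 1)
      rw [hT1, hT1, hT0, C_neg]; ring

/-- An automorphism `(h, f)` with `deg f < deg h = n` is uniquely of the form `(g + P(f), f)`
with `deg g ≤ deg f` and `P` a polynomial without constant and linear terms. -/
theorem card_strictDomAut [Finite F] (n : ℕ) : Nat.card (StrictDomAut F n) =
    ∑ m ∈ n.properDivisors, Nat.card (WeakDomAut F m) * Nat.card (ReducedPoly F (n / m)) := by
  rw [← Finset.sum_coe_sort]
  simp_rw [← Nat.card_prod]
  have hfin : ∀ k, Finite (ReducedPoly F k) := by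
    intro k
    have : Finite (Polynomial.degreeLT F (k + 1)) := Module.finite_of_finite F
    refine Finite.of_injective (β := Polynomial.degreeLT F (k + 1)) (fun P => ⟨P.1, ?_⟩)
      fun P Q h => Subtype.ext (congrArg (fun R => R.1) h)
    rw [Polynomial.mem_degreeLT]
    refine Polynomial.degree_le_natDegree.trans_lt ?_
    rw [P.2.1]
    exact_mod_cast Nat.lt_succ_self k
  rw [← Nat.card_sigma]
  refine (Nat.card_congr (Equiv.ofBijective
    (fun x : (m : n.properDivisors) × (WeakDomAut F m.1 × ReducedPoly F (n / m.1)) =>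
      (⟨(shear x.2.2.1).trans x.2.1.1, ?_, ?_⟩ : StrictDomAut F n)) ⟨?_, ?_⟩)).symm
  · obtain ⟨⟨m, hm⟩, ⟨φ, hφ0, hφ1⟩, ⟨P, hP, -⟩⟩ := x
    obtain ⟨hdvd, hlt⟩ := Nat.mem_properDivisors.mp hm
    have h1 : (Polynomial.aeval (φ (X 0)) P).totalDegree = n := by
      rw [totalDegree_aeval (totalDegree_apply_X_pos φ 0), hP, hφ0]
      exact Nat.div_mul_cancel hdvd
    change ((shear P).trans φ (X 0)).totalDegree = n
    rw [shear_trans_X_zero, totalDegree_add_eq_right_of_totalDegree_lt, h1]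
    rw [h1]; exact hφ1.trans_lt hlt
  · obtain ⟨⟨m, hm⟩, ⟨φ, hφ0, hφ1⟩, P⟩ := x
    change ((shear P.1).trans φ (X 1)).totalDegree < n
    rw [shear_trans_X_one, hφ0]
    exact (Nat.mem_properDivisors.mp hm).2
  · rintro ⟨⟨m, hm⟩, ⟨φ, hφ0, hφ1⟩, ⟨P, hP, hP0, hP1⟩⟩ ⟨⟨m', hm'⟩, ⟨ψ, hψ0, hψ1⟩, ⟨Q, hQ, hQ0, hQ1⟩⟩ h
    have h' : (shear P).trans φ = (shear Q).trans ψ := congrArg Subtype.val h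
    have h0 : φ (X 0) = ψ (X 0) := by rw [← shear_trans_X_one φ P, h', shear_trans_X_one]
    have h1 : φ (X 1) + Polynomial.aeval (φ (X 0)) P =
        ψ (X 1) + Polynomial.aeval (ψ (X 0)) Q := by
      rw [← shear_trans_X_zero φ P, h', shear_trans_X_zero]
    obtain rfl : m = m' := hφ0.symm.trans ((congrArg totalDegree h0).trans hψ0)
    have hpos := totalDegree_apply_X_pos φ 0
    have hPQ : P = Q := by
      have h2 : φ (X 1) - ψ (X 1) = Polynomial.aeval (φ (X 0)) (Q - P) := by
        rw [← h0] at h1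
        rw [map_sub]
        linear_combination h1
      have h3 := congrArg totalDegree h2
      rw [totalDegree_aeval hpos, hφ0] at h3
      have h4 := (totalDegree_sub (φ (X 1)) (ψ (X 1))).trans (max_le hφ1 hψ1)
      rw [h3] at h4
      have h5 : (Q - P).natDegree ≤ 1 := by
        by_contra h6
        rw [hφ0] at hpos
        nlinarith
      have h7 := Polynomial.eq_X_add_C_of_natDegree_le_one h5
      rw [Polynomial.coeff_sub, Polynomial.coeff_sub, hP0, hQ0, hP1, hQ1] at h7
      simp only [sub_self, map_zero, zero_mul, add_zero] at h7
      exact (sub_eq_zero.mp h7).symm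
    subst hPQ
    rw [h0, add_left_inj] at h1
    obtain rfl : φ = ψ := algEquiv_ext_fin_two h0 h1
    rfl
  · rintro ⟨φ, hφ0, hφ1⟩
    obtain ⟨P, hP0, hP1, hP⟩ := exists_reduction φ
    have hpos := totalDegree_apply_X_pos φ 1
    have hn' : n = P.natDegree * (φ (X 1)).totalDegree := by
      have h1 : φ (X 0) = (φ (X 0) - Polynomial.aeval (φ (X 1)) P)
          + Polynomial.aeval (φ (X 1)) P := by ring
      rw [← totalDegree_aeval hpos, ← hφ0]
      by_contra hne
      have h2 := totalDegree_sub (φ (X 0)) (Polynomial.aeval (φ (X 1)) P)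
      have h3 := totalDegree_add (φ (X 0) - Polynomial.aeval (φ (X 1)) P)
        (Polynomial.aeval (φ (X 1)) P)
      rw [← h1] at h3
      rcases lt_or_gt_of_ne hne with h4 | h4
      · have h5 : (φ (X 0) - Polynomial.aeval (φ (X 1)) P).totalDegree =
            (Polynomial.aeval (φ (X 1)) P).totalDegree := by
          rw [sub_eq_add_neg, totalDegree_add_eq_right_of_totalDegree_lt, totalDegree_neg]
          rwa [totalDegree_neg]
        omega
      · omega
    refine ⟨⟨⟨(φ (X 1)).totalDegree, Nat.mem_properDivisors.mpr ⟨⟨P.natDegree, ?_⟩, hφ1⟩⟩,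
      ⟨(shear P).symm.trans φ, ?_, ?_⟩, ⟨P, ?_, hP0, hP1⟩⟩, Subtype.ext (algEquiv_ext_fin_two ?_ ?_)⟩
    · rw [mul_comm]; exact hn'
    · rw [shear_symm_trans_X_zero]
    · rw [shear_symm_trans_X_one]; exact hP
    · exact (Nat.div_eq_of_eq_mul_left hpos hn').symm
    · change (shear P).trans ((shear P).symm.trans φ) (X 0) = φ (X 0)
      rw [shear_trans_X_zero, shear_symm_trans_X_zero, shear_symm_trans_X_one, sub_add_cancel]
    · change (shear P).trans ((shear P).symm.trans φ) (X 1) = φ (X 1)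
      rw [shear_trans_X_one, shear_symm_trans_X_zero]

/-- A polynomial of degree `k ≥ 2` without constant and linear terms is `a X ^ k + X ^ 2 R` with
`a ≠ 0` and `deg R < k - 2`. -/
theorem card_reducedPoly [Finite F] {k : ℕ} (hk : 2 ≤ k) :
    Nat.card (ReducedPoly F k) = (Nat.card F - 1) * Nat.card F ^ (k - 2) := by
  have e1 : Nat.card Fˣ = Nat.card F - 1 := Nat.card_units F
  have e2 : Nat.card (Polynomial.degreeLT F (k - 2)) = Nat.card F ^ (k - 2) := by
    rw [Nat.card_congr (Polynomial.degreeLTEquiv F (k - 2)).toEquiv, Nat.card_fun, Nat.card_fin]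
  rw [← e1, ← e2, ← Nat.card_prod]
  have hR : ∀ R : Polynomial.degreeLT F (k - 2), R.1.coeff (k - 2) = 0 := fun R =>
    Polynomial.coeff_eq_zero_of_degree_lt (Polynomial.mem_degreeLT.mp R.2)
  have hcoeff : ∀ (a : F) (R : Polynomial F) (j : ℕ),
      (Polynomial.monomial k a + Polynomial.X ^ 2 * R).coeff j =
        (if k = j then a else 0) + if 2 ≤ j then R.coeff (j - 2) else 0 := by
    intro a R j
    rw [Polynomial.coeff_add, Polynomial.coeff_monomial, Polynomial.coeff_X_pow_mul']
  refine (Nat.card_congr (Equiv.ofBijective (fun x : Fˣ × Polynomial.degreeLT F (k - 2) =>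
    (⟨Polynomial.monomial k (x.1 : F) + Polynomial.X ^ 2 * x.2.1, ?_, ?_, ?_⟩ : ReducedPoly F k))
    ⟨?_, ?_⟩)).symm
  · refine Polynomial.natDegree_eq_of_le_of_coeff_ne_zero ?_ ?_
    · rw [Polynomial.natDegree_le_iff_coeff_eq_zero]
      intro j hj
      rw [hcoeff, if_neg (by omega), if_pos (by omega), zero_add]
      refine Polynomial.coeff_eq_zero_of_degree_lt ((Polynomial.mem_degreeLT.mp x.2.2).trans_le ?_)
      exact_mod_cast (by omega : k - 2 ≤ j - 2)
    · rw [hcoeff, if_pos rfl, if_pos hk, hR, add_zero]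
      exact x.1.ne_zero
  · rw [hcoeff, if_neg (by omega), if_neg (by omega), add_zero]
  · rw [hcoeff, if_neg (by omega), if_neg (by omega), add_zero]
  · rintro ⟨a, R⟩ ⟨b, S⟩ h
    have h' := congrArg Subtype.val h
    dsimp only at h'
    have h1 := congrArg (fun P => Polynomial.coeff P k) h'
    rw [hcoeff, hcoeff, if_pos rfl, if_pos rfl, if_pos hk, if_pos hk, hR, hR, add_zero,
      add_zero] at h1
    obtain rfl : a = b := Units.ext h1
    rw [add_right_inj] at h'
    rw [Subtype.ext (mul_left_cancel₀ (pow_ne_zero 2 Polynomial.X_ne_zero) h')]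
  · rintro ⟨P, hP, hP0, hP1⟩
    have ha : P.coeff k ≠ 0 := by
      rw [← hP, Polynomial.coeff_natDegree, Ne, Polynomial.leadingCoeff_eq_zero]
      rintro rfl
      rw [Polynomial.natDegree_zero] at hP
      omega
    let R : Polynomial F := ∑ j ∈ Finset.range (k - 2), Polynomial.monomial j (P.coeff (j + 2))
    have hRc : ∀ j, R.coeff j = if j < k - 2 then P.coeff (j + 2) else 0 := by
      intro j
      simp [R, Polynomial.finsetSum_coeff, Polynomial.coeff_monomial]
    refine ⟨(Units.mk0 _ ha, ⟨R, ?_⟩), Subtype.ext (Polynomial.ext fun j => ?_)⟩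
    · rw [Polynomial.mem_degreeLT, Polynomial.degree_lt_iff_coeff_zero]
      intro j hj
      rw [hRc, if_neg (by omega)]
    · dsimp only [Units.val_mk0]
      rw [hcoeff, hRc]
      rcases lt_trichotomy j k with h | rfl | h
      · rw [if_neg (by omega), zero_add]
        split_ifs with h2 h3
        · rw [Nat.sub_add_cancel h2]
        · omega
        · have : j = 0 ∨ j = 1 := by omega
          rcases this with rfl | rfl
          · exact hP0.symm
          · exact hP1.symm
      · rw [if_pos rfl, if_pos hk, if_neg (by omega), add_zero]
      · rw [if_neg (by omega), if_pos (by omega), if_neg (by omega), add_zero,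
          Polynomial.coeff_eq_zero_of_natDegree_lt (by omega)]

end Counting

/-! ### Affine automorphisms -/

section Affine

variable {F : Type*} [Field F]

/-- The affine map `X i ↦ ∑ j, A i j X j + v i`. -/
noncomputable def affineHom (A : Matrix (Fin 2) (Fin 2) F) (v : Fin 2 → F) :
    MvPolynomial (Fin 2) F →ₐ[F] MvPolynomial (Fin 2) F :=
  aeval fun i => ∑ j, C (A i j) * X j + C (v i)

theorem affineHom_X (A : Matrix (Fin 2) (Fin 2) F) (v : Fin 2 → F)
    (i : Fin 2) : affineHom A v (X i) = ∑ j, C (A i j) * X j + C (v i) := by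
  rw [affineHom, aeval_X]

theorem affineHom_C (A : Matrix (Fin 2) (Fin 2) F) (v : Fin 2 → F)
    (c : F) : affineHom A v (C c) = C c := by
  rw [affineHom, aeval_C, algebraMap_eq]

theorem affineHom_comp (A B : Matrix (Fin 2) (Fin 2) F) (v w : Fin 2 → F)
    (hBA : B * A = 1) (hw : w = -(B.mulVec v)) :
    (affineHom A v).comp (affineHom B w) = AlgHom.id F _ := by
  ext i : 1
  have h : ∀ j, B i 0 * A 0 j + B i 1 * A 1 j = if i = j then 1 else 0 := by
    intro j
    rw [← Matrix.one_apply, ← hBA, Matrix.mul_apply, Fin.sum_univ_two]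
  have h' : ∀ j, (C (B i 0) * C (A 0 j) + C (B i 1) * C (A 1 j) : MvPolynomial (Fin 2) F) =
      if i = j then 1 else 0 := by
    intro j
    rw [← C_mul, ← C_mul, ← C_add, h]
    split_ifs <;> simp
  have e : (affineHom A v) (affineHom B w (X i)) =
      (C (B i 0) * C (A 0 0) + C (B i 1) * C (A 1 0)) * X 0
        + (C (B i 0) * C (A 0 1) + C (B i 1) * C (A 1 1)) * X 1 := by
    have hwi : (C (w i) : MvPolynomial (Fin 2) F) =
        -(C (B i 0) * C (v 0) + C (B i 1) * C (v 1)) := by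
      rw [hw, Pi.neg_apply, Matrix.mulVec, dotProduct, Fin.sum_univ_two]
      simp only [C_neg, C_add, C_mul]
    rw [affineHom_X, map_add, affineHom_C, Fin.sum_univ_two, map_add, map_mul, map_mul,
      affineHom_C, affineHom_C, affineHom_X, affineHom_X, Fin.sum_univ_two, Fin.sum_univ_two, hwi]
    ring
  rw [AlgHom.comp_apply, e, h', h']
  fin_cases i <;> simp

variable (F)

/-- The affine automorphism with invertible linear part `A` and translation vector `v`. -/
noncomputable def affineAut (A : GL (Fin 2) F) (v : Fin 2 → F) :
    MvPolynomial (Fin 2) F ≃ₐ[F] MvPolynomial (Fin 2) F :=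
  AlgEquiv.ofAlgHom (affineHom A.1 v) (affineHom A⁻¹.1 (-(A⁻¹.1.mulVec v)))
    (affineHom_comp _ _ _ _ (by rw [← Units.val_mul, inv_mul_cancel, Units.val_one]) rfl)
    (affineHom_comp _ _ _ _ (by rw [← Units.val_mul, mul_inv_cancel, Units.val_one]) (by
      rw [Matrix.mulVec_neg, neg_neg, Matrix.mulVec_mulVec, ← Units.val_mul, mul_inv_cancel,
        Units.val_one, Matrix.one_mulVec]))

theorem affineAut_X (A : GL (Fin 2) F) (v : Fin 2 → F) (i : Fin 2) :
    affineAut F A v (X i) = ∑ j, C (A.1 i j) * X j + C (v i) :=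
  affineHom_X A.1 v i

theorem eq_of_totalDegree_le_one {p : MvPolynomial (Fin 2) F} (hp : p.totalDegree ≤ 1) :
    p = ∑ j, C (coeff (Finsupp.single j 1) p) * X j + C (coeff 0 p) := by
  classical
  ext d
  rw [Fin.sum_univ_two, coeff_add, coeff_add, coeff_C_mul, coeff_C_mul, coeff_X, coeff_X,
    coeff_C]
  by_cases h0 : 0 = d
  · subst h0; simp
  by_cases h1 : Finsupp.single 0 1 = d
  · subst h1; simp [Finsupp.single_left_inj, h0]
  by_cases h2 : Finsupp.single 1 1 = d
  · subst h2; simp [Finsupp.single_left_inj, h0]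
  rw [if_neg h1, if_neg h2, if_neg h0, mul_zero, mul_zero, add_zero, add_zero]
  by_contra hne
  have h3 := (le_totalDegree (mem_support_iff.mpr hne)).trans hp
  rw [Finsupp.sum_fintype _ _ (by simp), Fin.sum_univ_two] at h3
  have h4 : (d 0 = 0 ∧ d 1 = 0) ∨ (d 0 = 1 ∧ d 1 = 0) ∨ (d 0 = 0 ∧ d 1 = 1) := by omega
  rcases h4 with ⟨ha, hb⟩ | ⟨ha, hb⟩ | ⟨ha, hb⟩
  · exact h0 (by ext j; fin_cases j <;> simp [ha, hb])
  · exact h1 (by ext j; fin_cases j <;> simp [ha, hb])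
  · exact h2 (by ext j; fin_cases j <;> simp [ha, hb])

theorem coeff_single_affine (a : Fin 2 → F) (b : F) (k : Fin 2) :
    coeff (Finsupp.single k 1) (∑ j, C (a j) * X j + C b) = a k := by
  classical
  rw [Fin.sum_univ_two, coeff_add, coeff_add, coeff_C_mul, coeff_C_mul, coeff_X, coeff_X, coeff_C,
    if_neg (Finsupp.single_ne_zero.mpr one_ne_zero).symm]
  fin_cases k <;> simp [Finsupp.single_left_inj]

theorem coeff_zero_affine (a : Fin 2 → F) (b : F) :
    coeff 0 (∑ j, C (a j) * X j + C b) = b := by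
  classical
  rw [Fin.sum_univ_two, coeff_add, coeff_add, coeff_C_mul, coeff_C_mul, coeff_X, coeff_X, coeff_C,
    if_pos rfl]
  simp

theorem totalDegree_affine_le (a : Fin 2 → F) (b : F) :
    (∑ j, C (a j) * X j + C b : MvPolynomial (Fin 2) F).totalDegree ≤ 1 := by
  have h : ∀ j, (C (a j) * X j : MvPolynomial (Fin 2) F).totalDegree ≤ 1 := fun j => by
    simpa using totalDegree_mul (C (a j)) (X j : MvPolynomial (Fin 2) F)
  rw [Fin.sum_univ_two]
  refine (totalDegree_add _ _).trans (max_le ((totalDegree_add _ _).trans (max_le (h 0) (h 1))) ?_)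
  simp

/-- The automorphisms of degree `1` are the affine ones. -/
theorem autCount_one_eq_card : autCount F 1 = Nat.card (GL (Fin 2) F) * Nat.card (Fin 2 → F) := by
  rw [autCount, ← Nat.card_prod]
  refine (Nat.card_congr (Equiv.ofBijective (fun x : GL (Fin 2) F × (Fin 2 → F) =>
    (⟨affineAut F x.1 x.2, ?_⟩ : {φ : MvPolynomial (Fin 2) F ≃ₐ[F] MvPolynomial (Fin 2) F //
      autDegree φ = 1})) ⟨?_, ?_⟩)).symm
  · have h := totalDegree_apply_X_pos (affineAut F x.1 x.2) 0
    have h0 := totalDegree_affine_le F (x.1.1 0) (x.2 0)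
    have h1 := totalDegree_affine_le F (x.1.1 1) (x.2 1)
    rw [← affineAut_X] at h0 h1
    rw [autDegree]
    omega
  · rintro ⟨A, v⟩ ⟨B, w⟩ h
    have h' : affineAut F A v = affineAut F B w := congrArg Subtype.val h
    have hX : ∀ i, ∑ j, C (A.1 i j) * X j + C (v i) = ∑ j, C (B.1 i j) * X j + C (w i) := by
      intro i
      rw [← affineAut_X, h', affineAut_X]
    refine Prod.ext (Units.ext (Matrix.ext fun i k => ?_)) (funext fun i => ?_)
    · have := congrArg (coeff (Finsupp.single k 1)) (hX i)
      rwa [coeff_single_affine, coeff_single_affine] at this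
    · have := congrArg (coeff 0) (hX i)
      rwa [coeff_zero_affine, coeff_zero_affine] at this
  · rintro ⟨φ, hφ⟩
    have hle : ∀ i, (φ (X i)).totalDegree ≤ 1 := by
      intro i
      rw [autDegree] at hφ
      fin_cases i
      · exact (le_max_left _ _).trans hφ.le
      · exact (le_max_right _ _).trans hφ.le
    let A : Matrix (Fin 2) (Fin 2) F := fun i j => coeff (Finsupp.single j 1) (φ (X i))
    have hφX : ∀ i, φ (X i) = ∑ j, C (A i j) * X j + C (coeff 0 (φ (X i))) := fun i =>
      eq_of_totalDegree_le_one F (hle i)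
    have hdet : A.det ≠ 0 := by
      intro h0
      obtain ⟨r, hr, hrA⟩ := Matrix.exists_vecMul_eq_zero_iff.mpr h0
      have hcol : ∀ j, r 0 * A 0 j + r 1 * A 1 j = 0 := fun j => by
        have := congrFun hrA j
        rwa [Matrix.vecMul, dotProduct, Fin.sum_univ_two] at this
      have hcol' : ∀ j, (C (r 0) * C (A 0 j) + C (r 1) * C (A 1 j) : MvPolynomial (Fin 2) F) = 0 :=
        fun j => by rw [← C_mul, ← C_mul, ← C_add, hcol, C_0]
      set b : F := r 0 * coeff 0 (φ (X 0)) + r 1 * coeff 0 (φ (X 1)) with hb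
      have hC : ∀ c : F, φ (C c) = C c := fun c => φ.commutes c
      have hφr : φ (∑ j, C (r j) * X j + C (-b)) = φ 0 := by
        rw [Fin.sum_univ_two, map_add, map_add, map_mul, map_mul, hC, hC, hC, map_zero, hφX 0,
          hφX 1, Fin.sum_univ_two, Fin.sum_univ_two, C_neg, hb, C_add, C_mul, C_mul]
        linear_combination X 0 * hcol' 0 + X 1 * hcol' 1
      have hz := φ.injective hφr
      refine hr (funext fun k => ?_)
      have := congrArg (coeff (Finsupp.single k 1)) hz
      rwa [coeff_single_affine, coeff_zero] at this
    refine ⟨(Matrix.GeneralLinearGroup.mkOfDetNeZero A hdet, fun i => coeff 0 (φ (X i))),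
      Subtype.ext (algEquiv_ext_fin_two ?_ ?_)⟩
    · exact (affineAut_X F _ _ 0).trans (hφX 0).symm
    · exact (affineAut_X F _ _ 1).trans (hφX 1).symm

theorem autCount_one [Fintype F] : (autCount F 1 : ℚ) =
    (Fintype.card F : ℚ) ^ 3 * ((Fintype.card F : ℚ) - 1) ^ 2 * ((Fintype.card F : ℚ) + 1) := by
  have hq : 1 ≤ Fintype.card F := Fintype.card_pos
  rw [autCount_one_eq_card, Matrix.card_GL_field, Nat.card_fun, Nat.card_fin, Fin.prod_univ_two,
    Nat.card_eq_fintype_card]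
  have h1 : Fintype.card F ^ 0 ≤ Fintype.card F ^ 2 := Nat.pow_le_pow_right hq (by omega)
  have h2 : Fintype.card F ^ 1 ≤ Fintype.card F ^ 2 := Nat.pow_le_pow_right hq (by omega)
  simp only [Fin.val_zero, Fin.val_one]
  rw [Nat.cast_mul, Nat.cast_mul, Nat.cast_sub h1, Nat.cast_sub h2]
  push_cast
  ring

end Affine

/-! ### Ordered factorizations and the Dirichlet inverse -/

section Factorizations

/-- The sum over ordered factorizations of `n`, with the weight `c ^ k * q ^ (n₁ + ⋯ + n_k)`. -/
noncomputable def factorizationSum (c q : ℚ) (n : ℕ) : ℚ :=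
  ∑ l ∈ orderedFactorizations n, c ^ l.length * q ^ l.sum

theorem mem_orderedFactorizations {n : ℕ} {l : List ℕ} :
    l ∈ orderedFactorizations n ↔ (∀ m ∈ l, 1 < m) ∧ l.prod = n := by
  rw [orderedFactorizations, Set.Finite.mem_toFinset]
  rfl

theorem factorizationSum_one (c q : ℚ) : factorizationSum c q 1 = 1 := by
  have : orderedFactorizations 1 = {[]} := by
    ext l
    rw [mem_orderedFactorizations, Finset.mem_singleton]
    constructor
    · rintro ⟨h1, h2⟩
      rcases l with - | ⟨a, t⟩
      · rfl
      · have ha := h1 a (by simp)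
        rw [List.prod_cons, mul_eq_one] at h2
        omega
    · rintro rfl
      simp
  simp [factorizationSum, this]

/-- Splitting off the first factor of an ordered factorization. -/
theorem factorizationSum_eq (c q : ℚ) {n : ℕ} (hn : 2 ≤ n) : factorizationSum c q n =
    ∑ m ∈ n.properDivisors, c * q ^ (n / m) * factorizationSum c q m := by
  simp_rw [factorizationSum, Finset.mul_sum]
  rw [Finset.sum_sigma']
  refine (Finset.sum_nbij' (fun x : (_ : ℕ) × List ℕ => n / x.1 :: x.2)
    (fun l => ⟨l.tail.prod, l.tail⟩) ?_ ?_ ?_ ?_ ?_).symm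
  · rintro ⟨m, t⟩ hx
    rw [Finset.mem_sigma, Nat.mem_properDivisors, mem_orderedFactorizations] at hx
    obtain ⟨⟨hdvd, hlt⟩, ht, hprod⟩ := hx
    dsimp only at hdvd hlt ht hprod
    rw [mem_orderedFactorizations]
    refine ⟨fun a ha => ?_, ?_⟩
    · rcases List.mem_cons.mp ha with rfl | ha
      · rw [Nat.lt_div_iff_mul_lt' hdvd]; omega
      · exact ht a ha
    · rw [List.prod_cons, hprod, Nat.div_mul_cancel hdvd]
  · rintro l hl
    rw [mem_orderedFactorizations] at hl
    obtain ⟨hl1, hl2⟩ := hl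
    rcases l with - | ⟨a, t⟩
    · rw [List.prod_nil] at hl2
      omega
    have ha := hl1 a (by simp)
    rw [List.prod_cons] at hl2
    rw [Finset.mem_sigma, Nat.mem_properDivisors, mem_orderedFactorizations]
    refine ⟨⟨⟨a, by rw [mul_comm]; exact hl2.symm⟩, ?_⟩, fun b hb => hl1 b (by simp_all), rfl⟩
    change t.prod < n
    have : 0 < t.prod := Nat.pos_of_ne_zero fun h => by rw [h] at hl2; omega
    nlinarith
  · rintro ⟨m, t⟩ hx
    rw [Finset.mem_sigma, mem_orderedFactorizations] at hx
    obtain ⟨-, -, hprod⟩ := hx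
    dsimp only at hprod
    subst hprod
    rfl
  · rintro l hl
    rw [mem_orderedFactorizations] at hl
    obtain ⟨hl1, hl2⟩ := hl
    rcases l with - | ⟨a, t⟩
    · rw [List.prod_nil] at hl2
      omega
    rw [List.prod_cons] at hl2
    have : 0 < t.prod := Nat.pos_of_ne_zero fun h => by rw [h] at hl2; omega
    change n / t.prod :: t = a :: t
    rw [Nat.div_eq_of_eq_mul_left this hl2.symm]
  · rintro ⟨m, t⟩ hx
    simp only [List.length_cons, List.sum_cons]
    ring

theorem arithmeticFunction_sub_apply (f g : ArithmeticFunction ℚ) (n : ℕ) :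
    (f - g) n = f n - g n := by
  rw [sub_eq_add_neg, ArithmeticFunction.add_apply, ArithmeticFunction.neg_apply, sub_eq_add_neg]

theorem rhoSeries_mul_factorizationSum (c q : ℚ) :
    (1 - c • rhoSeries q) * formalDirichletSeries (factorizationSum c q) = 1 := by
  ext n
  rcases eq_or_ne n 0 with rfl | hn0
  · simp
  set f : ArithmeticFunction ℚ := 1 - c • rhoSeries q with hf
  have hA : ∀ m, m ≠ 0 → formalDirichletSeries (factorizationSum c q) m = factorizationSum c q m :=
    fun m hm => if_neg hm
  have hf1 : f 1 = 1 := by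
    rw [hf, arithmeticFunction_sub_apply, ArithmeticFunction.smul_map]
    simp [rhoSeries, formalDirichletSeries]
  have hf2 : ∀ m, 2 ≤ m → f m = -(c * q ^ m) := by
    intro m hm
    rw [hf, arithmeticFunction_sub_apply, ArithmeticFunction.smul_map, smul_eq_mul]
    have h1 : rhoSeries q m = q ^ m := by
      change (if m = 0 then 0 else if 2 ≤ m then q ^ m else 0) = _
      rw [if_neg (by omega), if_pos hm]
    rw [h1, ArithmeticFunction.one_apply_ne (by omega), zero_sub]
  rw [ArithmeticFunction.mul_apply,
    Nat.sum_divisorsAntidiagonal' fun x y => f x * formalDirichletSeries (factorizationSum c q) y,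
    ← Nat.cons_self_properDivisors hn0, Finset.sum_cons, Nat.div_self (Nat.pos_of_ne_zero hn0), hf1,
    one_mul, hA n hn0]
  rcases eq_or_ne n 1 with rfl | hn1
  · simp [factorizationSum_one]
  have hn : 2 ≤ n := by omega
  rw [ArithmeticFunction.one_apply_ne hn1, factorizationSum_eq c q hn, ← Finset.sum_add_distrib]
  refine Finset.sum_eq_zero fun m hm => ?_
  obtain ⟨hdvd, hlt⟩ := Nat.mem_properDivisors.mp hm
  have hm0 : 0 < m := Nat.pos_of_dvd_of_pos hdvd (by omega)
  have h2 : 2 ≤ n / m := by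
    change 1 < n / m
    rw [Nat.lt_div_iff_mul_lt' hdvd]; omega
  rw [hf2 _ h2, hA m hm0.ne']
  ring

end Factorizations

/-! ### The recursion for the counts -/

section Counts

variable (F : Type*) [Field F] [Fintype F]

theorem card_strictDomAut_one : Nat.card (StrictDomAut F 1) = 0 := by
  rw [card_strictDomAut]
  simp

theorem card_weakDomAut_cast {n : ℕ} (hn : 2 ≤ n) : (Nat.card (WeakDomAut F n) : ℚ) =
    ∑ m ∈ n.properDivisors, ((Fintype.card F : ℚ) - 1) / Fintype.card F *
      (Fintype.card F : ℚ) ^ (n / m) * Nat.card (WeakDomAut F m) := by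
  have hq : 1 ≤ Fintype.card F := Fintype.card_pos
  have hq0 : (Fintype.card F : ℚ) ≠ 0 := by exact_mod_cast (by omega : Fintype.card F ≠ 0)
  rw [card_weakDomAut F hn, card_strictDomAut, Nat.card_eq_fintype_card (α := F), Finset.mul_sum,
    Nat.cast_sum]
  refine Finset.sum_congr rfl fun m hm => ?_
  obtain ⟨hdvd, hlt⟩ := Nat.mem_properDivisors.mp hm
  have h2 : 2 ≤ n / m := by
    change 1 < n / m
    rw [Nat.lt_div_iff_mul_lt' hdvd]; omega
  rw [card_reducedPoly F h2, Nat.card_eq_fintype_card (α := F)]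
  obtain ⟨k, hk⟩ := Nat.exists_eq_add_of_le h2
  rw [hk, Nat.add_sub_cancel_left, pow_add, Nat.cast_mul, Nat.cast_mul, Nat.cast_mul,
    Nat.cast_sub hq]
  push_cast
  field_simp

theorem card_weakDomAut_eq (n : ℕ) (hn : 1 ≤ n) : (Nat.card (WeakDomAut F n) : ℚ) =
    autCount F 1 * factorizationSum (((Fintype.card F : ℚ) - 1) / Fintype.card F)
      (Fintype.card F) n := by
  induction n using Nat.strong_induction_on with
  | _ n ih =>
    rcases eq_or_lt_of_le hn with rfl | hn2
    · rw [factorizationSum_one, mul_one, autCount_eq_add, card_strictDomAut_one, add_zero]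
    · rw [card_weakDomAut_cast F hn2, factorizationSum_eq _ _ hn2, Finset.mul_sum]
      refine Finset.sum_congr rfl fun m hm => ?_
      obtain ⟨hdvd, hlt⟩ := Nat.mem_properDivisors.mp hm
      rw [ih m hlt (Nat.pos_of_dvd_of_pos hdvd (by omega))]
      ring

theorem autCount_eq {n : ℕ} (hn : 1 < n) : (autCount F n : ℚ) =
    ((Fintype.card F : ℚ) * ((Fintype.card F : ℚ) - 1) * ((Fintype.card F : ℚ) + 1)) ^ 2 *
      factorizationSum (((Fintype.card F : ℚ) - 1) / Fintype.card F) (Fintype.card F) n := by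
  have hq0 : (Fintype.card F : ℚ) ≠ 0 := by exact_mod_cast Fintype.card_ne_zero
  have h1 := card_weakDomAut_eq F n hn.le
  have h2 : (Nat.card (WeakDomAut F n) : ℚ) = Fintype.card F * Nat.card (StrictDomAut F n) := by
    rw [card_weakDomAut F hn, Nat.card_eq_fintype_card, Nat.cast_mul]
  rw [autCount_one] at h1
  have h3 : (autCount F n : ℚ) * Fintype.card F =
      Nat.card (WeakDomAut F n) * (Fintype.card F + 1) := by
    rw [autCount_eq_add, Nat.cast_add]
    linear_combination -h2
  rw [← mul_left_inj' hq0, h3, h1]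
  ring

end Counts

/-- In the last part `1 / (1 - ((q - 1) / q) ρ(s))` is the inverse in the ring of formal Dirichlet
series; that it exists is part of the claim. -/
theorem theorem2p1 (F : Type*) [Field F] [Fintype F] (q : ℚ) (hq : q = (Fintype.card F : ℚ)) :
    (autCount F 1 : ℚ) = q ^ 3 * (q - 1) ^ 2 * (q + 1) ∧
    (∀ n : ℕ, 1 < n →
      (autCount F n : ℚ) = (q * (q - 1) * (q + 1)) ^ 2 *
        ∑ l ∈ orderedFactorizations n, ((q - 1) / q) ^ l.length * q ^ l.sum) ∧
    IsUnit (1 - ((q - 1) / q) • rhoSeries q) ∧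
    autSeries F = (q * (q - 1) * (q + 1)) ^ 2 •
      (Ring.inverse (1 - ((q - 1) / q) • rhoSeries q) -
        (1 / (q + 1)) • (1 : ArithmeticFunction ℚ)) := by
  have hmul := rhoSeries_mul_factorizationSum ((q - 1) / q) q
  have hunit : IsUnit (1 - ((q - 1) / q) • rhoSeries q) := IsUnit.of_mul_eq_one _ hmul
  have hinv : Ring.inverse (1 - ((q - 1) / q) • rhoSeries q) =
      formalDirichletSeries (factorizationSum ((q - 1) / q) q) := by
    have := congrArg (Ring.inverse (1 - ((q - 1) / q) • rhoSeries q) * ·) hmul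
    rwa [← mul_assoc, Ring.inverse_mul_cancel _ hunit, one_mul, mul_one, eq_comm] at this
  have hone := autCount_one F
  have hcount : ∀ n, 1 < n → (autCount F n : ℚ) = (q * (q - 1) * (q + 1)) ^ 2 *
      factorizationSum ((q - 1) / q) q n := fun n hn => by rw [hq]; exact autCount_eq F hn
  rw [← hq] at hone
  refine ⟨hone, hcount, hunit, ?_⟩
  have hq1 : q + 1 ≠ 0 := by
    have : (0 : ℚ) ≤ q := hq ▸ Nat.cast_nonneg _
    positivity
  rw [hinv]
  ext n
  rcases eq_or_ne n 0 with rfl | hn0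
  · simp
  have h1 : autSeries F n = autCount F n := if_neg hn0
  have h2 : formalDirichletSeries (factorizationSum ((q - 1) / q) q) n =
      factorizationSum ((q - 1) / q) q n := if_neg hn0
  rw [ArithmeticFunction.smul_map, arithmeticFunction_sub_apply, ArithmeticFunction.smul_map,
    smul_eq_mul, smul_eq_mul, h1, h2]
  rcases eq_or_ne n 1 with rfl | hn1
  · rw [hone, factorizationSum_one, ArithmeticFunction.one_one]
    field_simp
    ring
  · rw [hcount n (by omega), ArithmeticFunction.one_apply_ne hn1, mul_zero, sub_zero]
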